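/- Let $k$ be a perfect field of characteristic $p>0$ and let $X$ be a normal $k$-scheme which is locally essentially of finite type over $k$ (every point has an affine open neighbourhood whose coordinate ring is a localization of a finitely generated $k$-algebra; for example, any normal scheme locally of finite type over $k$). Here normal means that all local rings of $X$ are integrally closed domains. A Frobenius lifting of $X$ is a pair $(\widetilde X,\widetilde F)$, where $\widetilde X$ is a flat scheme over the ring $W_2(k)$ of length-two $p$-typical Witt vectors equipped with an isomorphism $\widetilde X\times_{\operatorname{Spec} W_2(k)}\operatorname{Spec} k\cong X$ of $k$-schemes, and $\widetilde F\colon\widetilde X\to\widetilde X$ is a morphism of schemes restricting to the absolute Frobenius $F_X\colon X\to X$. Let $(\widetilde X^{(1)},\widetilde F^{(1)})$ and $(\widetilde X^{(2)},\widetilde F^{(2)})$ be two Frobenius liftings of $X$. Then $\widetilde X^{(1)}\cong\widetilde X^{(2)}$ as liftings of $X$: there is an isomorphism of $W_2(k)$-schemes $\widetilde X^{(1)}\to\widetilde X^{(2)}$ which induces the identity on $X$. In other words, $X$ has, up to isomorphism of liftings, at most one flat lifting to $W_2(k)$ to which its Frobenius lifts. -/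

import Mathlib

open CategoryTheory Opposite TopologicalSpace AlgebraicGeometry

universe u

noncomputable section

namespace FrobLift

/-- The `p`-th power map of a commutative ring in which the prime `p` vanishes. (The zero ring is
allowed, since it occurs as the ring of sections over the empty set.) -/
def powHom (p : ℕ) [hp : Fact p.Prime] (R : Type u) [CommRing R] (h : (p : R) = 0) : R →+* R where
  toFun a := a ^ p
  map_one' := one_pow p
  map_zero' := zero_pow hp.out.ne_zero
  map_mul' a b := mul_pow a b p
  map_add' a b := by
    rw [add_pow_prime_eq hp.out, h]
    ring

/-- A scheme has characteristic `p` if `p = 0` in its ring of global functions. -/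
def HasCharP (p : ℕ) (X : Scheme.{u}) : Prop := (p : Γ(X, ⊤)) = 0

theorem HasCharP.sections {p : ℕ} {X : Scheme.{u}} (h : HasCharP p X) (U : X.Opens) :
    (p : Γ(X, U)) = 0 := by
  have := congrArg (X.presheaf.map (homOfLE (le_top : U ≤ ⊤)).op).hom h
  rwa [map_natCast, map_zero] at this

theorem hasCharP_of_hom {p : ℕ} {k : Type u} [Field k] [CharP k p] {X : Scheme.{u}}
    (f : X ⟶ Spec (CommRingCat.of k)) : HasCharP p X := by
  have h0 : ((p : ℕ) : CommRingCat.of k) = 0 := CharP.cast_eq_zero k p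
  have h1 := congrArg (Scheme.ΓSpecIso (CommRingCat.of k)).inv.hom h0
  rw [map_natCast, map_zero] at h1
  have h2 := congrArg f.appTop.hom h1
  rwa [map_natCast, map_zero] at h2

/-- The absolute Frobenius of a scheme of characteristic `p`, as a morphism of presheafed spaces:
the identity on points and `s ↦ s ^ p` on sections. -/
def absFrobeniusAux (p : ℕ) [Fact p.Prime] (X : Scheme.{u}) (h : HasCharP p X) :
    X.toPresheafedSpace.Hom X.toPresheafedSpace where
  base := 𝟙 _
  c :=
    { app := fun U => CommRingCat.ofHom (powHom p Γ(X, U.unop) (h.sections U.unop))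
      naturality := fun U V i => by
        ext a
        exact (map_pow (X.presheaf.map i).hom a p).symm }

theorem absFrobeniusAux_stalkMap (p : ℕ) [Fact p.Prime] (X : Scheme.{u}) (h : HasCharP p X)
    (x : X) (a : X.presheaf.stalk x) :
    (PresheafedSpace.Hom.stalkMap (absFrobeniusAux p X h) x).hom a = a ^ p := by
  obtain ⟨U, hx, s, rfl⟩ := X.presheaf.exists_germ_eq a
  have := PresheafedSpace.stalkMap_germ_apply (absFrobeniusAux p X h) U x hx s
  refine this.trans ?_
  exact map_pow (X.presheaf.germ U x hx).hom s p

/-- The absolute Frobenius morphism `F_X : X ⟶ X` of a scheme of characteristic `p`. -/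
def absFrobenius (p : ℕ) [hp : Fact p.Prime] (X : Scheme.{u}) (h : HasCharP p X) : X ⟶ X where
  toHom := absFrobeniusAux p X h
  prop x := ⟨fun a ha => by
    have ha' := ha
    erw [absFrobeniusAux_stalkMap p X h x a] at ha'
    exact (isUnit_pow_iff hp.out.ne_zero).1 ha'⟩

/-- The ring `W₂(k)` of `p`-typical Witt vectors of length two. -/
abbrev W2 (p : ℕ) [Fact p.Prime] (k : Type u) [CommRing k] : CommRingCat.{u} :=
  CommRingCat.of (TruncatedWittVector p 2 k)

/-- The reduction map `W₂(k) → k`, sending a Witt vector to its zeroth component. -/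
def W2.residue (p : ℕ) [Fact p.Prime] (k : Type u) [CommRing k] :
    TruncatedWittVector p 2 k →+* k where
  toFun x := x.coeff 0
  map_one' := WittVector.one_coeff_zero (p := p) (R := k)
  map_zero' := by simp
  map_mul' x y := by
    obtain ⟨a, rfl⟩ := WittVector.truncate_surjective p 2 k x
    obtain ⟨b, rfl⟩ := WittVector.truncate_surjective p 2 k y
    rw [← map_mul]
    simp only [WittVector.coeff_truncate]
    exact WittVector.mul_coeff_zero a b
  map_add' x y := by
    obtain ⟨a, rfl⟩ := WittVector.truncate_surjective p 2 k x
    obtain ⟨b, rfl⟩ := WittVector.truncate_surjective p 2 k y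
    rw [← map_add]
    simp only [WittVector.coeff_truncate]
    exact WittVector.add_coeff_zero a b

/-- A (flat) lifting to `W₂(k)` of a `k`-scheme `f : X ⟶ Spec k`: a flat `W₂(k)`-scheme together
with an identification of `X` with its base change to `k`. -/
structure W2Lifting (p : ℕ) [Fact p.Prime] {k : Type u} [Field k] {X : Scheme.{u}}
    (f : X ⟶ Spec (CommRingCat.of k)) where
  /-- The lifted scheme. -/
  scheme : Scheme.{u}
  /-- Its structure morphism. -/
  str : scheme ⟶ Spec (W2 p k)
  flat : Flat str
  /-- The inclusion of the special fibre. -/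
  incl : X ⟶ scheme
  isPullback : IsPullback incl f str (Spec.map (CommRingCat.ofHom (W2.residue p k)))

/-- A Frobenius lifting of a `k`-scheme `f : X ⟶ Spec k`: a lifting of `X` to `W₂(k)` with a
morphism to itself restricting to the absolute Frobenius of `X`. -/
structure FrobeniusLifting (p : ℕ) [Fact p.Prime] {k : Type u} [Field k] [CharP k p]
    {X : Scheme.{u}} (f : X ⟶ Spec (CommRingCat.of k)) extends W2Lifting p f where
  /-- The lift of Frobenius. -/
  frob : scheme ⟶ scheme
  incl_frob : incl ≫ frob = absFrobenius p X (hasCharP_of_hom f) ≫ incl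

/-- A scheme is normal if all its local rings are integrally closed domains. -/
class IsNormal (X : Scheme.{u}) : Prop where
  isDomain : ∀ x : X, IsDomain (X.presheaf.stalk x)
  isIntegrallyClosed : ∀ x : X, IsIntegrallyClosed (X.presheaf.stalk x)

/-- A `k`-scheme is locally essentially of finite type if every point has an affine open
neighbourhood whose ring is a localization of a finitely generated `k`-algebra. In particular
every `k`-scheme locally of finite type has this property. -/
def LocallyEssFiniteType {k : Type u} [Field k] {X : Scheme.{u}}
    (f : X ⟶ Spec (CommRingCat.of k)) : Prop :=
  ∀ x : X, ∃ U : X.Opens, x ∈ U ∧ IsAffineOpen U ∧ (f.appLE ⊤ U le_top).hom.EssFiniteType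

end FrobLift

end

/-! Locally, a lift of Frobenius `F` on a flat thickening `T` of `A` gives the `p`-derivation `δ x =
(F x - x ^ p) / p` with values in `A`. Replacing `x` by `x + p * y` adds `y ^ p` to `δ x`. If `σ` is
a Frobenius splitting of `A`, then `σ (δ x)` changes by exactly `y`, so `x` is determined by the
pair of its reduction and `σ (δ x)`. The formulas for `δ` of sums and products turn the ring
operations into universal formulas in these pairs. Hence one splitting `σ` identifies any two
thickenings of `A` that carry Frobenius lifts (`compare`).

To glue these local isomorphisms, `σ` must be canonical. The first lifting supplies it. Its divided
Frobenius differential sends `a` to the form `a ^ (p - 1) da + d (δ x)`, where `x` lifts `a`. For a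
`p`-basis `x i` of the fraction field this form is `x i ^ p * (dlog x i + d (g i))`, with `g i = δ /
x i ^ p`. The splitting is the Cartier operator applied to `f` times the wedge of the forms `dlog x
i + d (g i)`, read relative to the wedge of the `dlog x i`. It sends `1` to `1` because the exact
terms contribute nothing; in coordinates this is the Piola identity for cofactors
(`constCoeff_det_logJacobian`). It is the only normalized splitting that kills the images of all
derivations pairing to `p`-th powers with these forms (`eq_splitting`). So it depends neither on the
`p`-basis nor on the chosen affine open.

It remains to see that `σ` preserves `A`. A noetherian normal domain is tested at those primes whose
local ring is a discrete valuation ring. There a uniformizer together with lifts of a `p`-basis of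
the residue field is a `p`-basis of the fraction field (`isPBasis_consFamily`), and in these
coordinates the poles of the logarithmic forms cancel (`splitting_mem`). Linearity over `W₂(k)`
needs no further construction: maps out of `W₂(k)` are determined modulo `p` when `k` is perfect. -/

noncomputable section

namespace FrobLift

/-! ### Derivations of determinants and the Piola identity -/

section Piola

variable {S R ι : Type*} [CommRing S] [CommRing R] [Algebra S R] [DecidableEq ι]

theorem derivation_prod (D : Derivation S R R) (f : ι → R) (s : Finset ι) :
    D (∏ i ∈ s, f i) = ∑ l ∈ s, ∏ i ∈ s, Function.update f l (D (f l)) i := by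
  induction s using Finset.induction_on with
  | empty => simp
  | insert a s ha ih =>
    rw [Finset.prod_insert ha, Derivation.leibniz, ih, Finset.sum_insert ha,
      Finset.prod_insert ha, Function.update_self, smul_eq_mul, smul_eq_mul, add_comm,
      Finset.mul_sum]
    congr 1
    · rw [mul_comm]
      congr 1
      refine Finset.prod_congr rfl fun i hi => ?_
      rw [Function.update_of_ne (by rintro rfl; exact ha hi)]
    · refine Finset.sum_congr rfl fun l hl => ?_
      rw [Finset.prod_insert ha, Function.update_of_ne (by rintro rfl; exact ha hl)]

variable [Fintype ι]

theorem derivation_det (D : Derivation S R R) (M : Matrix ι ι R) :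
    D M.det = ∑ l, (M.updateRow l fun j => D (M l j)).det := by
  rw [← Matrix.det_transpose, Matrix.det_apply, map_sum]
  have h (l : ι) : (M.updateRow l fun j => D (M l j)).det =
      ∑ σ : Equiv.Perm ι, Equiv.Perm.sign σ •
        ∏ i, (M.updateRow l fun j => D (M l j)) i (σ i) := by
    rw [← Matrix.det_transpose, Matrix.det_apply]; rfl
  simp_rw [h]
  rw [Finset.sum_comm]
  refine Finset.sum_congr rfl fun σ _ => ?_
  rw [← Finset.smul_sum, Units.smul_def, map_zsmul, ← Units.smul_def]
  congr 1
  have := derivation_prod D (fun i => M i (σ i)) Finset.univ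
  refine this.trans (Finset.sum_congr rfl fun l _ => Finset.prod_congr rfl fun i _ => ?_)
  by_cases h : i = l
  · subst h; simp
  · simp [h]

/-- Swapping the indices cancels off-diagonal terms in pairs. The diagonal needs its own hypothesis,
because antisymmetry does not make it vanish in characteristic two. -/
theorem sum_symm_mul_alternating (s B : ι → ι → R) (hs : ∀ i j, s i j = s j i)
    (hB : ∀ i, B i i = 0) (hB' : ∀ i j, i ≠ j → B i j = -B j i) :
    ∑ i, ∑ j, s i j * B i j = 0 := by
  rw [← Finset.sum_product']
  refine Finset.sum_involution (fun x _ => x.swap) ?_ ?_ ?_ ?_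
  · rintro ⟨i, j⟩ -
    by_cases h : i = j
    · subst h; simp [hB]
    · simp [hs j i, hB' i j h]
  · rintro ⟨i, j⟩ - h h'
    have : j = i := congrArg Prod.fst h'
    subst this
    exact h (by simp [hB])
  · simp
  · simp

/-- **Piola identity**: the columns of the adjugate of a matrix with closed rows are
divergence-free. -/
theorem sum_derivation_adjugate (θ : ι → Derivation S R R) (M : Matrix ι ι R)
    (hM : ∀ i j k, θ k (M i j) = θ j (M i k)) (i : ι) :
    ∑ j, θ j (M.adjugate j i) = 0 := by
  simp_rw [Matrix.adjugate_apply, derivation_det]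
  rw [Finset.sum_comm]
  refine Finset.sum_eq_zero fun l _ => ?_
  -- In the cofactor, row `i` is a constant unit vector, so differentiating that row gives zero.
  by_cases hl : l = i
  · subst hl
    refine Finset.sum_eq_zero fun j _ => Matrix.det_eq_zero_of_row_eq_zero l fun m => ?_
    by_cases hm : m = j
    · subst hm; simp
    · simp [hm]
  -- Expanding the differentiated row `l` in unit vectors gives a double sum over `j` and `m`: the
  -- factor `θ j (M l m)` is symmetric by closedness, and the remaining minor is alternating.
  · have key (j : ι) (v : ι → R) :
        ((M.updateRow i (Pi.single j 1)).updateRow l v).det =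
          ∑ m, v m * ((M.updateRow i (Pi.single j 1)).updateRow l (Pi.single m 1)).det := by
      have hv : ∑ m, v m • (Pi.single m 1 : ι → R) = v := by
        ext a
        rw [Finset.sum_apply, Finset.sum_eq_single a] <;>
          simp +contextual [eq_comm]
      have := ((Matrix.detRowAlternating (R := R) (n := ι)).toMultilinearMap.map_update_sum
        Finset.univ l (fun m => v m • (Pi.single m 1 : ι → R)) (M.updateRow i (Pi.single j 1)))
      refine Eq.trans ?_ (this.trans (Finset.sum_congr rfl fun m _ => ?_))
      · rw [hv]; rfl
      · exact Matrix.det_updateRow_smul _ _ _ _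
    refine (Finset.sum_congr rfl fun j _ => key j _).trans ?_
    simp only [Matrix.updateRow_ne hl]
    refine sum_symm_mul_alternating (fun j m => θ j (M l m))
      (fun j m => ((M.updateRow i (Pi.single j 1)).updateRow l (Pi.single m 1)).det)
      (fun j m => hM l m j) (fun j => ?_) (fun j m _ => ?_)
    · refine Matrix.det_zero_of_row_eq (Ne.symm hl) ?_
      rw [Matrix.updateRow_ne (Ne.symm hl), Matrix.updateRow_self, Matrix.updateRow_self]
    · have h1 := (Matrix.detRowAlternating (R := R) (n := ι)).map_swap
        ((M.updateRow i (Pi.single m 1)).updateRow l (Pi.single j 1)) (Ne.symm hl)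
      refine Eq.trans (congrArg Matrix.det ?_) h1
      ext a b
      change _ = (M.updateRow i (Pi.single m 1)).updateRow l (Pi.single j 1) (Equiv.swap i l a) b
      by_cases ha : a = l
      · subst ha
        simp [Matrix.updateRow_apply, Ne.symm hl]
      · by_cases ha' : a = i
        · subst ha'
          simp [Matrix.updateRow_apply, ha]
        · simp [Matrix.updateRow_apply, ha, ha', Equiv.swap_apply_of_ne_of_ne]

end Piola

/-! ### `p`-bases and their Euler derivations -/

section PBasis

/-- The subfield of `p`-th powers of a field of characteristic `p`. -/
abbrev pthPowers (p : ℕ) [Fact p.Prime] (K : Type*) [Field K] [CharP K p] : Subfield K :=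
  (frobenius K p).fieldRange

/-- The monomial in the family `x` with exponents the least nonnegative residues of `α`. -/
def pMonomial {p : ℕ} {K ι : Type*} [CommRing K] [Fintype ι] (x : ι → K) (α : ι → ZMod p) : K :=
  ∏ i, x i ^ (α i).val

theorem pMonomial_zero {p : ℕ} {K ι : Type*} [CommRing K] [Fintype ι] (x : ι → K) :
    pMonomial x (0 : ι → ZMod p) = 1 := by
  simp [pMonomial]

theorem derivation_pow_eq_zero (p : ℕ) {S R : Type*} [CommRing S] [CommRing R] [Algebra S R] [CharP R p]
    (D : Derivation S R R) (z : R) : D (z ^ p) = 0 := by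
  rw [Derivation.leibniz_pow, nsmul_eq_mul, CharP.cast_eq_zero, zero_mul]

theorem pMonomial_single (p : ℕ) [Fact p.Prime] {K ι : Type*} [CommRing K]
    [Fintype ι] [DecidableEq ι] (x : ι → K) (i : ι) :
    pMonomial x (Pi.single i (1 : ZMod p)) = x i := by
  rw [pMonomial, Finset.prod_eq_single i]
  · rw [Pi.single_eq_same, ZMod.val_one, pow_one]
  · intro j _ hj
    simp [Pi.single_eq_of_ne hj]
  · simp

theorem derivation_sum_apply {S R α : Type*} [CommRing S] [CommRing R] [Algebra S R]
    (s : Finset α) (D : α → Derivation S R R) (f : R) : (∑ i ∈ s, D i) f = ∑ i ∈ s, D i f := by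
  classical
  induction s using Finset.induction_on with
  | empty => simp
  | insert a s ha ih => rw [Finset.sum_insert ha, Finset.sum_insert ha, Derivation.add_apply, ih]

variable (p : ℕ) [hp : Fact p.Prime] {K ι : Type*} [Field K] [CharP K p] [Fintype ι]

theorem pow_mem_pthPowers (z : K) : z ^ p ∈ pthPowers p K := ⟨z, rfl⟩

theorem coe_castHom_pthPowers (z : ZMod p) :
    ((ZMod.castHom (dvd_refl p) (pthPowers p K) z : pthPowers p K) : K) =
      ZMod.castHom (dvd_refl p) K z :=
  RingHom.congr_fun (Subsingleton.elim ((pthPowers p K).subtype.comp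
    (ZMod.castHom (dvd_refl p) (pthPowers p K))) (ZMod.castHom (dvd_refl p) K)) z

/-- Monomials are graded by exponents modulo `p`; a carry in the addition of exponents contributes a
factor `x i ^ p`, which is a scalar. -/
theorem pMonomial_mul (x : ι → K) (α β : ι → ZMod p) :
    ∃ c : pthPowers p K, pMonomial x α * pMonomial x β = c • pMonomial x (α + β) := by
  refine ⟨⟨(∏ i, x i ^ (((α i).val + (β i).val) / p)) ^ p, pow_mem_pthPowers p _⟩, ?_⟩
  rw [Subfield.smul_def, smul_eq_mul]
  simp only [pMonomial]
  rw [← Finset.prod_pow, ← Finset.prod_mul_distrib, ← Finset.prod_mul_distrib]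
  refine Finset.prod_congr rfl fun i _ => ?_
  rw [Pi.add_apply, ZMod.val_add, ← pow_mul, ← pow_add, ← pow_add, mul_comm _ p, Nat.div_add_mod]

/-- A finite family is a `p`-basis of the field `K` if the monomials with exponents less than `p`
form a basis of `K` over the subfield of `p`-th powers. -/
structure IsPBasis (x : ι → K) : Prop where
  linearIndependent : LinearIndependent (pthPowers p K) (pMonomial (p := p) x)
  span_eq_top : ⊤ ≤ Submodule.span (pthPowers p K) (Set.range (pMonomial (p := p) x))

namespace IsPBasis

variable {p} {x : ι → K} (h : IsPBasis p x)

/-- The basis of monomials attached to a `p`-basis. -/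
def basis : Module.Basis (ι → ZMod p) (pthPowers p K) K :=
  Module.Basis.mk h.linearIndependent h.span_eq_top

@[simp]
theorem basis_apply (α : ι → ZMod p) : h.basis α = pMonomial x α :=
  Module.Basis.mk_apply _ _ _

include h in
theorem ne_zero (i : ι) : x i ≠ 0 := by
  classical
  rw [← pMonomial_single p x i, ← h.basis_apply]
  exact h.basis.ne_zero _

/-- The Euler operator multiplying a monomial by its `i`-th exponent, as a linear map. -/
def eulerLinear (i : ι) : K →ₗ[pthPowers p K] K :=
  h.basis.constr (pthPowers p K) fun α => ZMod.castHom (dvd_refl p) K (α i) * pMonomial x α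

theorem eulerLinear_pMonomial (i : ι) (α : ι → ZMod p) :
    h.eulerLinear i (pMonomial x α) = ZMod.castHom (dvd_refl p) K (α i) * pMonomial x α := by
  rw [← h.basis_apply, eulerLinear, Module.Basis.constr_basis, h.basis_apply]

/-- The Euler derivation multiplying a monomial by its `i`-th exponent. -/
def euler (i : ι) : Derivation (pthPowers p K) K K :=
  Derivation.mk' (h.eulerLinear i) fun a b => by
    -- The Leibniz rule is an equality of bilinear maps, so it suffices to check pairs of monomials,
    -- where exponents add modulo `p`.
    let B₁ : K →ₗ[pthPowers p K] K →ₗ[pthPowers p K] K :=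
      (LinearMap.mul (pthPowers p K) K).compr₂ (h.eulerLinear i)
    let B₂ : K →ₗ[pthPowers p K] K →ₗ[pthPowers p K] K :=
      (LinearMap.mul (pthPowers p K) K).compl₁₂ LinearMap.id (h.eulerLinear i) +
      (LinearMap.mul (pthPowers p K) K).compl₁₂ (h.eulerLinear i) LinearMap.id
    have hB : B₁ = B₂ := by
      refine h.basis.ext fun α => h.basis.ext fun β => ?_
      change h.eulerLinear i (h.basis α * h.basis β) = h.basis α * h.eulerLinear i (h.basis β) +
        h.eulerLinear i (h.basis α) * h.basis β
      simp only [basis_apply, eulerLinear_pMonomial]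
      obtain ⟨c, hc⟩ := pMonomial_mul p x α β
      have h1 := hc
      rw [Subfield.smul_def, smul_eq_mul] at h1
      rw [hc, map_smul, eulerLinear_pMonomial, Subfield.smul_def, smul_eq_mul, Pi.add_apply,
        map_add]
      linear_combination (-(ZMod.castHom (dvd_refl p) K) (α i) -
        (ZMod.castHom (dvd_refl p) K) (β i)) * h1
    have := congrArg (fun B => B a b) hB
    change h.eulerLinear i (a * b) = a * h.eulerLinear i b + h.eulerLinear i a * b at this
    rw [this, smul_eq_mul, smul_eq_mul, mul_comm b]

theorem euler_pMonomial (i : ι) (α : ι → ZMod p) :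
    h.euler i (pMonomial x α) = ZMod.castHom (dvd_refl p) K (α i) * pMonomial x α :=
  h.eulerLinear_pMonomial i α

theorem euler_basis (i : ι) (α : ι → ZMod p) : h.euler i (h.basis α) =
    ZMod.castHom (dvd_refl p) (pthPowers p K) (α i) • h.basis α := by
  rw [basis_apply, euler_pMonomial, Subfield.smul_def, smul_eq_mul, coe_castHom_pthPowers]

theorem euler_comm (i j : ι) (f : K) : h.euler i (h.euler j f) = h.euler j (h.euler i f) := by
  have : (h.euler i : K →ₗ[pthPowers p K] K) ∘ₗ (h.euler j : K →ₗ[pthPowers p K] K) =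
      (h.euler j : K →ₗ[pthPowers p K] K) ∘ₗ (h.euler i : K →ₗ[pthPowers p K] K) := by
    refine h.basis.ext fun α => ?_
    change h.euler i (h.euler j (h.basis α)) = h.euler j (h.euler i (h.basis α))
    have hs (z : ZMod p) : ∃ c : pthPowers p K, ZMod.castHom (dvd_refl p) K z = c :=
      ⟨_, (coe_castHom_pthPowers p z).symm⟩
    obtain ⟨a, ha⟩ := hs (α i)
    obtain ⟨b, hb⟩ := hs (α j)
    have e (c : pthPowers p K) (z : K) : (c : K) * z = c • z := rfl
    rw [h.basis_apply, euler_pMonomial, euler_pMonomial, ha, hb, e, e, Derivation.map_smul,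
      Derivation.map_smul, euler_pMonomial, euler_pMonomial, ha, hb, e, e, smul_comm]
  exact congrArg (fun B => B f) this

theorem euler_apply_self [DecidableEq ι] (i j : ι) :
    h.euler i (x j) = if i = j then x j else 0 := by
  conv_lhs => rw [← pMonomial_single p x j]
  rw [euler_pMonomial, pMonomial_single]
  split_ifs with hij
  · subst hij; simp
  · simp [Pi.single_eq_of_ne hij]

include h in
theorem derivation_ext {D₁ D₂ : Derivation (pthPowers p K) K K} (hD : ∀ i, D₁ (x i) = D₂ (x i)) :
    D₁ = D₂ := by
  ext f
  have hm (α : ι → ZMod p) : pMonomial x α ∈ Algebra.adjoin (pthPowers p K) (Set.range x) :=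
    Subalgebra.prod_mem _ fun i _ =>
      Subalgebra.pow_mem _ (Algebra.subset_adjoin (Set.mem_range_self i)) _
  have h1 : Set.EqOn D₁ D₂ (Algebra.adjoin (pthPowers p K) (Set.range x)) :=
    Derivation.eqOn_adjoin (Set.eqOn_range.2 (funext hD))
  have : (D₁ : K →ₗ[pthPowers p K] K) = D₂ := h.basis.ext fun α => by
    rw [h.basis_apply]; exact h1 (hm α)
  exact congrArg (fun B => B f) this

/-- The Euler derivations are `x j * ∂/∂x j`, dual to the forms `dlog x j`; a derivation is
determined by its values on the `p`-basis. -/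
theorem derivation_eq (D : Derivation (pthPowers p K) K K) (f : K) :
    D f = ∑ j, D (x j) / x j * h.euler j f := by
  classical
  have : D = ∑ j, (D (x j) / x j) • h.euler j := h.derivation_ext fun i => by
    rw [derivation_sum_apply]
    simp only [Derivation.smul_apply, euler_apply_self, smul_eq_mul]
    simp [h.ne_zero i]
  conv_lhs => rw [this]
  rw [derivation_sum_apply]
  rfl

/-- The monomials are joint eigenvectors, and only the trivial one has all eigenvalues zero. -/
theorem mem_of_euler_eq_zero {u : K} (hu : ∀ i, h.euler i u = 0) : u ∈ pthPowers p K := by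
  classical
  have key (α : ι → ZMod p) (hα : α ≠ 0) : h.basis.repr u α = 0 := by
    obtain ⟨i, hi⟩ : ∃ i, α i ≠ 0 := by
      by_contra! hc
      exact hα (funext hc)
    have h1 : (h.basis.coord α) ∘ₗ (h.euler i : K →ₗ[pthPowers p K] K) =
        (ZMod.castHom (dvd_refl p) (pthPowers p K) (α i)) • h.basis.coord α := by
      refine h.basis.ext fun β => ?_
      change h.basis.coord α (h.euler i (h.basis β)) =
        ZMod.castHom (dvd_refl p) (pthPowers p K) (α i) • h.basis.coord α (h.basis β)
      rw [euler_basis, map_smul]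
      by_cases hβ : β = α
      · subst hβ; rfl
      · rw [Module.Basis.coord_apply, Module.Basis.repr_self,
          Finsupp.single_eq_of_ne (Ne.symm hβ), smul_zero, smul_zero]
    have h2 := congrArg (fun B => B u) h1
    change h.basis.coord α (h.euler i u) =
      ZMod.castHom (dvd_refl p) (pthPowers p K) (α i) • h.basis.coord α u at h2
    rw [hu, map_zero, eq_comm, smul_eq_mul, mul_eq_zero] at h2
    refine h2.resolve_left fun h3 => hi ?_
    exact (map_eq_zero_iff _ (ZMod.castHom (dvd_refl p) (pthPowers p K)).injective).1 h3
  rw [← h.basis.sum_repr u, Finset.sum_eq_single 0]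
  · rw [basis_apply, pMonomial_zero, Subfield.smul_def, smul_eq_mul, mul_one]
    exact Subtype.property _
  · intro α _ hα
    rw [key α hα, zero_smul]
  · simp

/-- The coefficient of the trivial monomial. -/
def constCoeff : K →ₗ[pthPowers p K] pthPowers p K := h.basis.coord 0

theorem constCoeff_pMonomial [DecidableEq ι] (α : ι → ZMod p) :
    h.constCoeff (pMonomial x α) = if α = 0 then 1 else 0 := by
  rw [← h.basis_apply, constCoeff, Module.Basis.coord_apply, Module.Basis.repr_self,
    Finsupp.single_apply]

theorem constCoeff_one : h.constCoeff 1 = 1 := by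
  classical
  rw [← pMonomial_zero (p := p) x, constCoeff_pMonomial, if_pos rfl]

/-- In logarithmic coordinates this says that the Cartier operator kills exact top forms. -/
theorem constCoeff_euler (i : ι) (f : K) : h.constCoeff (h.euler i f) = 0 := by
  classical
  have h1 : h.constCoeff ∘ₗ (h.euler i : K →ₗ[pthPowers p K] K) = 0 := by
    refine h.basis.ext fun β => ?_
    change h.constCoeff (h.euler i (h.basis β)) = 0
    rw [euler_basis, map_smul, basis_apply, constCoeff_pMonomial]
    split_ifs with hβ
    · subst hβ; simp
    · simp
  exact congrArg (fun B => B f) h1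

end IsPBasis

end PBasis

/-! ### The splitting defined by logarithmic forms -/

namespace IsPBasis

variable {p : ℕ} [hp : Fact p.Prime] {K ι : Type*} [Field K] [CharP K p] [Fintype ι]
  [DecidableEq ι] {x : ι → K} (h : IsPBasis p x)

/-- The matrix of the logarithmic forms `dlog x i + d (g i)` in the basis `dlog x j`. -/
def logJacobian (g : ι → K) : Matrix ι ι K :=
  Matrix.of fun i j => (if i = j then 1 else 0) + h.euler j (g i)

theorem logJacobian_apply (g : ι → K) (i j : ι) :
    h.logJacobian g i j = (if i = j then 1 else 0) + h.euler j (g i) := rfl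

/-- The rows are closed forms: the identity matrix is constant and the Euler derivations commute.
This is the hypothesis of the Piola identity. -/
theorem euler_logJacobian (g : ι → K) (i j k : ι) :
    h.euler k (h.logJacobian g i j) = h.euler j (h.logJacobian g i k) := by
  have e (P : Prop) [Decidable P] (l : ι) : h.euler l (if P then 1 else 0) = 0 := by
    split_ifs <;> simp
  rw [logJacobian_apply, logJacobian_apply, map_add, map_add, e, e, euler_comm]

theorem sum_euler_adjugate (g : ι → K) (i : ι) :
    ∑ j, h.euler j ((h.logJacobian g).adjugate j i) = 0 :=
  sum_derivation_adjugate h.euler _ (h.euler_logJacobian g) i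

-- Integration by parts: pairing a divergence-free field `v` with the gradient of `f` gives the
-- divergence of `f v`.
omit [DecidableEq ι] in
theorem constCoeff_mul_sum_euler (v : ι → K) (f : K) (hv : ∑ j, h.euler j (v j) = 0) :
    h.constCoeff (∑ j, v j * h.euler j f) = 0 := by
  have : ∑ j, v j * h.euler j f = ∑ j, h.euler j (v j * f) := by
    simp_rw [Derivation.leibniz, Finset.sum_add_distrib, smul_eq_mul]
    rw [← Finset.mul_sum, hv, mul_zero, add_zero]
  rw [this, map_sum]
  exact Finset.sum_eq_zero fun j _ => h.constCoeff_euler j _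

/-- The potential `g a` enters only row `a`, and additively. Its contribution to the determinant
pairs the gradient of `g a` with a column of cofactors, which is divergence-free. -/
theorem constCoeff_det_update (g : ι → K) (a : ι) :
    h.constCoeff (h.logJacobian g).det =
      h.constCoeff (h.logJacobian (Function.update g a 0)).det := by
  set N := h.logJacobian (Function.update g a 0) with hN
  have h1 : h.logJacobian g = N.updateRow a (N a + fun j => h.euler j (g a)) := by
    ext i j
    by_cases hi : i = a
    · subst hi
      simp [hN, logJacobian_apply]
    · simp [hN, logJacobian_apply, hi]
  rw [h1, Matrix.det_updateRow_add, Matrix.updateRow_eq_self, map_add, add_eq_left]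
  rw [Matrix.det_eq_sum_mul_adjugate_row _ a]
  have h2 (j : ι) : (N.updateRow a fun j => h.euler j (g a)).adjugate j a = N.adjugate j a := by
    rw [Matrix.adjugate_apply, Matrix.adjugate_apply]
    congr 1
    simp
  simp_rw [h2, Matrix.updateRow_self, mul_comm (h.euler _ (g a))]
  exact h.constCoeff_mul_sum_euler _ _ (h.sum_euler_adjugate _ a)

/-- Switching off the potentials one at a time reduces to the identity matrix. -/
theorem constCoeff_det_logJacobian (g : ι → K) : h.constCoeff (h.logJacobian g).det = 1 := by
  have key (s : Finset ι) : ∀ g : ι → K, (∀ i ∉ s, g i = 0) →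
      h.constCoeff (h.logJacobian g).det = 1 := by
    induction s using Finset.induction_on with
    | empty =>
      intro g hg
      have : h.logJacobian g = 1 := by
        ext i j
        rw [logJacobian_apply, hg i (by simp), map_zero, add_zero, Matrix.one_apply]
      rw [this, Matrix.det_one, constCoeff_one]
    | insert a s ha ih =>
      intro g hg
      rw [constCoeff_det_update h g a]
      refine ih _ fun i hi => ?_
      by_cases hia : i = a
      · subst hia; simp
      · rw [Function.update_of_ne hia]
        exact hg i (by simp [hia, hi])
  exact key Finset.univ g (by simp)

/-- The splitting of `K` over the subfield of `p`-th powers determined by a `p`-basis `x` and the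
logarithmic forms `dlog x i + d (g i)`. -/
def splitting (g : ι → K) : K →ₗ[pthPowers p K] pthPowers p K :=
  h.constCoeff ∘ₗ LinearMap.mulRight (pthPowers p K) (h.logJacobian g).det

theorem splitting_apply (g : ι → K) (f : K) :
    h.splitting g f = h.constCoeff (f * (h.logJacobian g).det) := rfl

theorem splitting_one (g : ι → K) : h.splitting g 1 = 1 := by
  rw [splitting_apply, one_mul, constCoeff_det_logJacobian]

theorem det_logJacobian_ne_zero (g : ι → K) : (h.logJacobian g).det ≠ 0 := fun h0 => by
  have := h.constCoeff_det_logJacobian g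
  rw [h0, map_zero] at this
  exact zero_ne_one this

omit [DecidableEq ι] in
theorem constCoeff_smul_mul (c : pthPowers p K) (f : K) :
    h.constCoeff ((c : K) * f) = c * h.constCoeff f := by
  have : (c : K) * f = c • f := rfl
  rw [this, map_smul, smul_eq_mul]

/-- By Cramer's rule, `det M` times the coordinates of `D` is the adjugate applied to the pairings
`c i`. These are constants for the Euler derivations, so the resulting vector is divergence-free by
Piola and integration by parts applies. -/
theorem splitting_derivation (g : ι → K) (D : Derivation (pthPowers p K) K K)
    (hD : ∀ i, D (x i) / x i + D (g i) ∈ pthPowers p K) (f : K) :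
    h.splitting g (D f) = 0 := by
  set M := h.logJacobian g with hM
  set d : ι → K := fun j => D (x j) / x j with hd
  choose c hc using fun i => show ∃ c : pthPowers p K, D (x i) / x i + D (g i) = c from
    ⟨⟨_, hD i⟩, rfl⟩
  have h1 : M.mulVec d = fun i => (c i : K) := by
    ext i
    rw [Matrix.mulVec, dotProduct, ← hc, h.derivation_eq D (g i)]
    simp_rw [hM, logJacobian_apply, add_mul, Finset.sum_add_distrib]
    simp [hd, mul_comm]
  have h2 : M.det • d = M.adjugate.mulVec fun i => (c i : K) := by
    rw [← h1, Matrix.mulVec_mulVec, Matrix.adjugate_mul, Matrix.smul_mulVec, Matrix.one_mulVec]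
  have h3 (j : ι) : M.det * d j = ∑ i, M.adjugate j i * c i := congrFun h2 j
  rw [splitting_apply, h.derivation_eq D f, Finset.sum_mul]
  have h4 : ∑ j, d j * h.euler j f * M.det = ∑ j, (M.det * d j) * h.euler j f :=
    Finset.sum_congr rfl fun j _ => by ring
  rw [h4]
  refine h.constCoeff_mul_sum_euler _ _ ?_
  simp_rw [h3, map_sum]
  rw [Finset.sum_comm]
  refine Finset.sum_eq_zero fun i _ => ?_
  have h5 (j : ι) : h.euler j (M.adjugate j i * c i) = c i * h.euler j (M.adjugate j i) := by
    have : M.adjugate j i * c i = c i • M.adjugate j i := mul_comm _ _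
    rw [this, Derivation.map_smul]; rfl
  simp_rw [h5]
  rw [← Finset.mul_sum, h.sum_euler_adjugate, mul_zero]

/-- The derivations dual to the forms `dlog x i + d (g i)`. -/
def dualDerivation (g : ι → K) (i : ι) : Derivation (pthPowers p K) K K :=
  ∑ j, (h.logJacobian g)⁻¹ j i • h.euler j

theorem dualDerivation_apply (g : ι → K) (i : ι) (f : K) :
    h.dualDerivation g i f = ∑ j, (h.logJacobian g)⁻¹ j i * h.euler j f := by
  rw [dualDerivation, derivation_sum_apply]; rfl

theorem dualDerivation_pairing (g : ι → K) (i l : ι) :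
    h.dualDerivation g i (x l) / x l + h.dualDerivation g i (g l) = if l = i then 1 else 0 := by
  have h1 := Matrix.mul_nonsing_inv (h.logJacobian g)
    (Ne.isUnit (h.det_logJacobian_ne_zero g))
  have h2 : (h.logJacobian g * (h.logJacobian g)⁻¹) l i = if l = i then 1 else 0 := by
    rw [h1, Matrix.one_apply]
  rw [← h2, Matrix.mul_apply, dualDerivation_apply, dualDerivation_apply]
  simp_rw [logJacobian_apply, add_mul, Finset.sum_add_distrib, euler_apply_self]
  congr 1
  · simp [h.ne_zero l]
  · exact Finset.sum_congr rfl fun j _ => mul_comm _ _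

theorem euler_eq_sum_dualDerivation (g : ι → K) (j : ι) (f : K) :
    h.euler j f = ∑ i, h.logJacobian g i j * h.dualDerivation g i f := by
  have h1 := Matrix.nonsing_inv_mul (h.logJacobian g)
    (Ne.isUnit (h.det_logJacobian_ne_zero g))
  simp_rw [dualDerivation_apply, Finset.mul_sum]
  rw [Finset.sum_comm]
  have h2 (l : ι) : ∑ i, h.logJacobian g i j * ((h.logJacobian g)⁻¹ l i * h.euler l f) =
      (if l = j then 1 else 0) * h.euler l f := by
    rw [← Matrix.one_apply, ← h1, Matrix.mul_apply, Finset.sum_mul]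
    exact Finset.sum_congr rfl fun i _ => by ring
  simp_rw [h2]
  simp

/-- A splitting killing the image of the dual derivations is unique. -/
theorem eq_splitting (g : ι → K) (τ : K →ₗ[pthPowers p K] pthPowers p K) (h1 : τ 1 = 1)
    (hτ : ∀ i f, τ (h.dualDerivation g i f) = 0)  : τ = h.splitting g := by
  have hfin : Module.Finite (pthPowers p K) K := Module.Finite.of_basis h.basis
  -- By finiteness of `K` over its `p`-th powers, every linear form is `f ↦ splitting (u * f)` for
  -- some `u`; it remains to show `u = 1`.
  let B : K →ₗ[pthPowers p K] (K →ₗ[pthPowers p K] pthPowers p K) :=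
    (LinearMap.mul (pthPowers p K) K).compr₂ (h.splitting g)
  have hB (u f : K) : B u f = h.splitting g (u * f) := rfl
  have hinj : Function.Injective B := by
    rw [← LinearMap.ker_eq_bot, LinearMap.ker_eq_bot']
    intro u hu
    by_contra hne
    have := congrArg (fun τ => τ u⁻¹) hu
    simp only [hB, mul_inv_cancel₀ hne, splitting_one, LinearMap.zero_apply] at this
    exact one_ne_zero this
  have hsurj : Function.Surjective B :=
    (LinearMap.injective_iff_surjective_of_finrank_eq_finrank
      (by rw [Module.finrank_linearMap_self])).1 hinj
  obtain ⟨u, rfl⟩ := hsurj τ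
  have hpair (i l : ι) : h.dualDerivation g i (x l) / x l + h.dualDerivation g i (g l) ∈
      pthPowers p K := by
    rw [dualDerivation_pairing]
    split_ifs
    · exact one_mem _
    · exact zero_mem _
  -- If `D u ≠ 0`, put `w = (D u)⁻¹`. The splitting kills `D (u * w) = u * D w + w * D u`, and `τ`
  -- kills `D w`, so the splitting would kill `w * D u = 1`.
  have hu (i : ι) : h.dualDerivation g i u = 0 := by
    by_contra hne
    set D := h.dualDerivation g i
    have e1 := h.splitting_derivation g D (hpair i) (u * (D u)⁻¹)
    have e2 := hτ i (D u)⁻¹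
    rw [hB] at e2
    rw [Derivation.leibniz, map_add, smul_eq_mul, smul_eq_mul, e2, zero_add,
      inv_mul_cancel₀ hne, splitting_one] at e1
    exact one_ne_zero e1
  have hmem : u ∈ pthPowers p K := h.mem_of_euler_eq_zero fun j => by
    rw [h.euler_eq_sum_dualDerivation g]
    exact Finset.sum_eq_zero fun i _ => by rw [hu, mul_zero]
  have hu1 : B u 1 = ⟨u, hmem⟩ := by
    rw [hB, splitting_apply, mul_assoc, h.constCoeff_smul_mul ⟨u, hmem⟩, ← splitting_apply,
      splitting_one, mul_one]
  rw [h1] at hu1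
  have hu2 : u = 1 := (congrArg Subtype.val hu1).symm
  subst hu2
  ext f
  rw [hB, one_mul]

end IsPBasis

/-! ### The additive defect of the `p`-th power -/

section FrobDefect

/-- The polynomial `((x + y) ^ p - x ^ p - y ^ p) / p`. -/
def frobDefect (p : ℕ) {R : Type*} [CommRing R] (x y : R) : R :=
  ∑ j ∈ Finset.range (p - 1), ((p.choose (j + 1) / p : ℕ) : R) * (x ^ (j + 1) * y ^ (p - 1 - j))

theorem map_frobDefect (p : ℕ) {R S : Type*} [CommRing R] [CommRing S] (f : R →+* S) (x y : R) :
    f (frobDefect p x y) = frobDefect p (f x) (f y) := by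
  simp [frobDefect]

theorem frobDefect_zero_right (p : ℕ) {R : Type*} [CommRing R] (a : R) : frobDefect p a 0 = 0 := by
  refine Finset.sum_eq_zero fun j hj => ?_
  rw [Finset.mem_range] at hj
  rw [zero_pow (by omega), mul_zero, mul_zero]

variable (p : ℕ) [hp : Fact p.Prime] {R : Type*} [CommRing R]

theorem add_pow_eq_frobDefect (x y : R) :
    (x + y) ^ p = x ^ p + y ^ p + p * frobDefect p x y := by
  obtain ⟨q, rfl⟩ : ∃ q, p = q + 1 := ⟨p - 1, by have := hp.out.pos; omega⟩
  rw [add_pow, Finset.sum_range_succ, Finset.sum_range_succ', frobDefect, Finset.mul_sum]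
  have : ∀ j ∈ Finset.range (q + 1 - 1), ((q + 1 : ℕ) : R) *
      ((((q + 1).choose (j + 1) / (q + 1) : ℕ) : R) * (x ^ (j + 1) * y ^ (q + 1 - 1 - j))) =
      x ^ (j + 1) * y ^ (q + 1 - (j + 1)) * ((q + 1).choose (j + 1) : ℕ) := by
    intro j hj
    rw [Finset.mem_range] at hj
    have h1 : (q + 1) * ((q + 1).choose (j + 1) / (q + 1)) = (q + 1).choose (j + 1) :=
      Nat.mul_div_cancel' (hp.out.dvd_choose_self (by omega) (by omega))
    rw [← mul_assoc, ← Nat.cast_mul, h1, mul_comm, show q + 1 - (j + 1) = q + 1 - 1 - j by omega]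
  rw [Finset.sum_congr rfl this]
  simp
  ring

/-- Formally one differentiates `(x + y) ^ p - x ^ p - y ^ p` and divides by `p`. As `p` may be zero
in `R`, the division is done on the binomial coefficients in the natural numbers. -/
theorem derivation_frobDefect {S : Type*} [CommRing S] [Algebra S R] (D : Derivation S R R)
    (x y : R) : D (frobDefect p x y) =
      ((x + y) ^ (p - 1) - x ^ (p - 1)) * D x + ((x + y) ^ (p - 1) - y ^ (p - 1)) * D y := by
  obtain ⟨q, rfl⟩ : ∃ q, p = q + 1 := ⟨p - 1, by have := hp.out.pos; omega⟩
  have h1 (j : ℕ) (hj : j ∈ Finset.range q) :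
      D ((((q + 1).choose (j + 1) / (q + 1) : ℕ) : R) * (x ^ (j + 1) * y ^ (q - j))) =
      x ^ j * y ^ (q - j) * (q.choose j : R) * D x +
        x ^ (j + 1) * y ^ (q - (j + 1)) * (q.choose (j + 1) : R) * D y := by
    rw [Finset.mem_range] at hj
    have e1 : (q + 1) * ((q + 1).choose (j + 1) / (q + 1)) = (q + 1).choose (j + 1) :=
      Nat.mul_div_cancel' (hp.out.dvd_choose_self (by omega) (by omega))
    set c := (q + 1).choose (j + 1) / (q + 1)
    have e2 : c * (j + 1) = q.choose j := by
      have := Nat.add_one_mul_choose_eq q j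
      rw [← e1] at this
      exact Nat.eq_of_mul_eq_mul_left (Nat.succ_pos q) (by rw [← mul_assoc]; exact this.symm)
    have e3 : c * (q - j) = q.choose (j + 1) := by
      have h3 := Nat.choose_mul_succ_eq q (j + 1)
      rw [← e1, show q + 1 - (j + 1) = q - j by omega] at h3
      exact Nat.eq_of_mul_eq_mul_left (Nat.succ_pos q) (by
        rw [← mul_assoc]; exact h3.symm.trans (mul_comm _ _))
    rw [Derivation.leibniz, Derivation.map_natCast, Derivation.leibniz, Derivation.leibniz_pow,
      Derivation.leibniz_pow, ← e2, ← e3, Nat.sub_sub]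
    simp only [nsmul_eq_mul, smul_eq_mul, Nat.add_sub_cancel]
    push_cast [Nat.cast_sub hj.le]
    ring
  simp only [frobDefect, map_sum, Nat.add_sub_cancel]
  rw [Finset.sum_congr rfl h1, Finset.sum_add_distrib, ← Finset.sum_mul, ← Finset.sum_mul]
  congr 2
  · rw [add_pow, Finset.sum_range_succ]; simp
  · rw [add_pow, Finset.sum_range_succ']; simp

end FrobDefect

/-! ### Thickenings with a Frobenius lift, and their comparison through a Frobenius splitting -/

/-- A flat thickening modulo `p ^ 2` of a ring of characteristic `p` with a lift of Frobenius. -/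
structure FrobeniusThickening (p : ℕ) (A T : Type*) [CommRing A] [CommRing T] where
  /-- The reduction. -/
  red : T →+* A
  /-- The lift of Frobenius. -/
  frob : T →+* T
  red_surjective : Function.Surjective red
  red_eq_zero_iff (x : T) : red x = 0 ↔ ∃ y, x = p * y
  mul_eq_zero_iff (x : T) : p * x = 0 ↔ red x = 0
  red_frob (x : T) : red (frob x) = red x ^ p

namespace FrobeniusThickening

variable {p : ℕ} {A T T' : Type*} [CommRing A] [CommRing T] [CommRing T']

section

variable (P : FrobeniusThickening p A T)

theorem red_natCast_mul (x : T) : P.red (p * x) = 0 := (P.red_eq_zero_iff _).2 ⟨x, rfl⟩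

theorem mul_eq_mul_iff (x y : T) : p * x = p * y ↔ P.red x = P.red y := by
  rw [← sub_eq_zero, ← mul_sub, P.mul_eq_zero_iff, map_sub, sub_eq_zero]

theorem exists_frob_eq (x : T) : ∃ y, P.frob x = x ^ p + p * y := by
  obtain ⟨y, hy⟩ := (P.red_eq_zero_iff (P.frob x - x ^ p)).1 (by
    rw [map_sub, P.red_frob, map_pow, sub_self])
  exact ⟨y, by rw [← hy]; ring⟩

/-- The `p`-derivation `x ↦ (F x - x ^ p) / p`. -/
def delta (x : T) : A := P.red (P.exists_frob_eq x).choose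

theorem delta_eq {x y : T} (h : P.frob x = x ^ p + p * y) : P.delta x = P.red y := by
  refine (P.mul_eq_mul_iff _ _).1 (add_left_cancel (a := x ^ p) ?_)
  rw [← (P.exists_frob_eq x).choose_spec, h]

theorem exists_delta (x : T) : ∃ y, P.frob x = x ^ p + p * y ∧ P.delta x = P.red y :=
  ⟨_, (P.exists_frob_eq x).choose_spec, rfl⟩

theorem delta_mul (x y : T) :
    P.delta (x * y) = P.red x ^ p * P.delta y + P.red y ^ p * P.delta x := by
  obtain ⟨a, ha, ha'⟩ := P.exists_delta x
  obtain ⟨b, hb, hb'⟩ := P.exists_delta y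
  rw [P.delta_eq (y := x ^ p * b + y ^ p * a + p * (a * b)), map_add, P.red_natCast_mul, ha', hb']
  · simp
  · rw [map_mul, ha, hb]; ring

variable [hp : Fact p.Prime]

theorem delta_add (x y : T) :
    P.delta (x + y) = P.delta x + P.delta y - frobDefect p (P.red x) (P.red y) := by
  obtain ⟨a, ha, ha'⟩ := P.exists_delta x
  obtain ⟨b, hb, hb'⟩ := P.exists_delta y
  rw [P.delta_eq (y := a + b - frobDefect p x y), map_sub, map_frobDefect, map_add, ha', hb']
  rw [map_add, ha, hb, add_pow_eq_frobDefect]; ring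

include P in
theorem natCast_mul_pow (y : T) : (p * y) ^ p = 0 := by
  obtain ⟨q, hq⟩ : ∃ q, p = q + 2 := ⟨p - 2, by have := hp.out.two_le; omega⟩
  have : (p : T) * (p * y) = 0 := (P.mul_eq_zero_iff _).2 (P.red_natCast_mul y)
  have h2 : (p * y) ^ (q + 2) = (p * y) ^ q * y * (p * (p * y)) := by ring
  rw [this, mul_zero, ← hq] at h2
  exact h2

theorem delta_natCast_mul (y : T) : P.delta (p * y) = P.red y ^ p := by
  rw [P.delta_eq (y := P.frob y), P.red_frob]
  rw [P.natCast_mul_pow, map_mul, map_natCast, zero_add]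

/-- The lifts of one residue form a torsor under `A`, on which `δ` moves through Frobenius. After
applying a Frobenius splitting, `δ` becomes a coordinate on this torsor. -/
theorem delta_add_natCast_mul (x y : T) : P.delta (x + p * y) = P.delta x + P.red y ^ p := by
  rw [P.delta_add, P.red_natCast_mul, frobDefect_zero_right, P.delta_natCast_mul, sub_zero]

theorem pow_eq_pow {x y : T} (h : P.red x = P.red y) : x ^ p = y ^ p := by
  obtain ⟨z, hz⟩ := (P.red_eq_zero_iff (x - y)).1 (by rw [map_sub, h, sub_self])
  have : x = y + p * z := by rw [← hz]; ring
  rw [this, add_pow_eq_frobDefect, P.natCast_mul_pow, add_zero, add_eq_left]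
  rw [P.mul_eq_zero_iff, map_frobDefect, P.red_natCast_mul, frobDefect_zero_right]

end

/-- An additive map splitting the Frobenius endomorphism of a ring. -/
structure IsFrobeniusSplitting (p : ℕ) (σ : A → A) : Prop where
  map_add (a b : A) : σ (a + b) = σ a + σ b
  map_pow_mul (a b : A) : σ (a ^ p * b) = a * σ b
  map_one : σ 1 = 1

namespace IsFrobeniusSplitting

variable {σ : A → A} (hσ : IsFrobeniusSplitting p σ)

include hσ

theorem map_pow (a : A) : σ (a ^ p) = a := by
  rw [← mul_one (a ^ p), hσ.map_pow_mul, hσ.map_one, mul_one]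

theorem map_sub (a b : A) : σ (a - b) = σ a - σ b := by
  rw [eq_sub_iff_add_eq, ← hσ.map_add, sub_add_cancel]

end IsFrobeniusSplitting

section Comparison

variable [hp : Fact p.Prime] (P : FrobeniusThickening p A T) (P' : FrobeniusThickening p A T')
  {σ : A → A}

theorem eq_of_red_eq_of_delta_eq (hσ : IsFrobeniusSplitting p σ) {x y : T}
    (h : P.red x = P.red y) (h' : σ (P.delta x) = σ (P.delta y)) : x = y := by
  obtain ⟨z, hz⟩ := (P.red_eq_zero_iff (x - y)).1 (by rw [map_sub, h, sub_self])
  have hx : x = y + p * z := by rw [← hz]; ring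
  rw [hx, P.delta_add_natCast_mul, hσ.map_add, hσ.map_pow, add_eq_left] at h'
  rw [hx, (P.mul_eq_zero_iff z).2 h', add_zero]

theorem exists_red_eq_delta_eq (hσ : IsFrobeniusSplitting p σ) (x : T) :
    ∃ y : T', P'.red y = P.red x ∧ σ (P'.delta y) = σ (P.delta x) := by
  obtain ⟨y, hy⟩ := P'.red_surjective (P.red x)
  -- Adding `p * z` shifts `σ ∘ δ` by the reduction of `z`, so `z` must lift the discrepancy.
  obtain ⟨z, hz⟩ := P'.red_surjective (σ (P.delta x) - σ (P'.delta y))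
  refine ⟨y + p * z, by rw [map_add, hy, P'.red_natCast_mul, add_zero], ?_⟩
  rw [P'.delta_add_natCast_mul, hσ.map_add, hσ.map_pow, hz]
  ring

/-- The comparison of two thickenings determined by a Frobenius splitting, as a function. -/
def compareFun (hσ : IsFrobeniusSplitting p σ) (x : T) : T' :=
  (exists_red_eq_delta_eq P P' hσ x).choose

theorem red_compareFun (hσ : IsFrobeniusSplitting p σ) (x : T) :
    P'.red (compareFun P P' hσ x) = P.red x :=
  (exists_red_eq_delta_eq P P' hσ x).choose_spec.1

theorem delta_compareFun (hσ : IsFrobeniusSplitting p σ) (x : T) :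
    σ (P'.delta (compareFun P P' hσ x)) = σ (P.delta x) :=
  (exists_red_eq_delta_eq P P' hσ x).choose_spec.2

/-- The comparison isomorphism of two thickenings determined by a Frobenius splitting. -/
def compare (hσ : IsFrobeniusSplitting p σ) : T ≃+* T' where
  toFun := compareFun P P' hσ
  invFun := compareFun P' P hσ
  left_inv x := P.eq_of_red_eq_of_delta_eq hσ
    (by rw [red_compareFun, red_compareFun])
    ((delta_compareFun _ _ hσ _).trans (delta_compareFun _ _ hσ _))
  right_inv x := P'.eq_of_red_eq_of_delta_eq hσ
    (by rw [red_compareFun, red_compareFun])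
    ((delta_compareFun _ _ hσ _).trans (delta_compareFun _ _ hσ _))
  -- In `delta_mul` the coefficients of `δ` are `p`-th powers of reductions, and in `delta_add` the
  -- correction depends on reductions only. So `σ ∘ δ` of a product or sum is a function of the
  -- reductions and of `σ ∘ δ` of the factors or summands.
  map_mul' x y := P'.eq_of_red_eq_of_delta_eq hσ
    (by simp only [red_compareFun, map_mul]) (by
      simp only [delta_compareFun, delta_mul, hσ.map_add, hσ.map_pow_mul, red_compareFun])
  map_add' x y := P'.eq_of_red_eq_of_delta_eq hσ
    (by simp only [red_compareFun, map_add]) (by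
      simp only [delta_compareFun, delta_add, hσ.map_add, hσ.map_sub, red_compareFun])

theorem red_compare (hσ : IsFrobeniusSplitting p σ) (x : T) :
    P'.red (compare P P' hσ x) = P.red x := red_compareFun P P' hσ x

theorem delta_compare (hσ : IsFrobeniusSplitting p σ) (x : T) :
    σ (P'.delta (compare P P' hσ x)) = σ (P.delta x) := delta_compareFun P P' hσ x

end Comparison

/-- The comparison isomorphisms are compatible with maps of thickenings commuting with the
splittings. -/
theorem compare_map [hp : Fact p.Prime] (P : FrobeniusThickening p A T)
    (P' : FrobeniusThickening p A T')
    {B U U' : Type*} [CommRing B] [CommRing U] [CommRing U'] (Q : FrobeniusThickening p B U)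
    (Q' : FrobeniusThickening p B U') {σ : A → A} {τ : B → B} (hσ : IsFrobeniusSplitting p σ)
    (hτ : IsFrobeniusSplitting p τ) (f : A →+* B) (g : T →+* U) (g' : T' →+* U')
    (hg : ∀ x, Q.red (g x) = f (P.red x)) (hg' : ∀ x, Q'.red (g' x) = f (P'.red x))
    (hF : ∀ x, Q.delta (g x) = f (P.delta x)) (hF' : ∀ x, Q'.delta (g' x) = f (P'.delta x))
    (hf : ∀ a, τ (f a) = f (σ a)) (x : T) :
    compare Q Q' hτ (g x) = g' (compare P P' hσ x) := by
  refine Q'.eq_of_red_eq_of_delta_eq hτ ?_ ?_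
  · rw [red_compare, hg, hg', red_compare]
  · exact (delta_compare Q Q' hτ _).trans (by rw [hF, hF', hf, hf, delta_compare P P' hσ])

theorem delta_map (P : FrobeniusThickening p A T) {B U : Type*} [CommRing B] [CommRing U]
    (Q : FrobeniusThickening p B U) (f : A →+* B) (g : T →+* U)
    (hg : ∀ x, Q.red (g x) = f (P.red x)) (hF : ∀ x, Q.frob (g x) = g (P.frob x)) (x : T) :
    Q.delta (g x) = f (P.delta x) := by
  obtain ⟨y, hy, hy'⟩ := P.exists_delta x
  rw [hy', ← hg]
  refine Q.delta_eq ?_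
  rw [hF, hy]
  simp

end FrobeniusThickening

/-! ### The divided Frobenius differential and canonical splittings of the fraction field -/

/-- The inverse of the Frobenius of a field, as an additive map on `p`-th powers. -/
def pthRoot (p : ℕ) [Fact p.Prime] (K : Type*) [Field K] [CharP K p] : pthPowers p K →+ K where
  toFun w := w.2.choose
  map_zero' := frobenius_inj K p ((0 : pthPowers p K).2.choose_spec.trans (by simp))
  map_add' a b := frobenius_inj K p ((a + b).2.choose_spec.trans (by
    rw [map_add, a.2.choose_spec, b.2.choose_spec]; rfl))

theorem pthRoot_pow (p : ℕ) [Fact p.Prime] {K : Type*} [Field K] [CharP K p]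
    (w : pthPowers p K) : pthRoot p K w ^ p = w := w.2.choose_spec

namespace FrobeniusThickening

section Form

variable {p : ℕ} [hp : Fact p.Prime] {A T K : Type*} [CommRing A] [CommRing T] [Field K]
  [Algebra A K] (P : FrobeniusThickening p A T)

/-- The pairing of a derivation with the form `a ^ (p - 1) da + d (δ x)`, where `a` is the
reduction of `x`. -/
def form (D : Derivation ℤ K K) (x : T) : K :=
  algebraMap A K (P.red x) ^ (p - 1) * D (algebraMap A K (P.red x)) +
    D (algebraMap A K (P.delta x))

/-- The failure of `a ^ (p - 1) da` to be additive cancels against the derivative of the defect in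
`delta_add`. -/
theorem form_add (D : Derivation ℤ K K) (x y : T) : P.form D (x + y) = P.form D x + P.form D y := by
  simp only [form, delta_add, map_add, map_sub, map_frobDefect, derivation_frobDefect]
  ring

variable [CharP K p] (D : Derivation ℤ K K)

theorem form_mul (x y : T) : P.form D (x * y) =
    algebraMap A K (P.red x) ^ p * P.form D y + algebraMap A K (P.red y) ^ p * P.form D x := by
  have h (a : K) : a ^ p = a ^ (p - 1) * a := by
    rw [← pow_succ, Nat.sub_add_cancel hp.out.one_le]
  simp only [form, delta_mul, map_add, map_mul, map_pow, Derivation.leibniz,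
    derivation_pow_eq_zero p D, smul_eq_mul, mul_zero, add_zero, mul_pow]
  rw [h (algebraMap A K (P.red x)), h (algebraMap A K (P.red y))]
  ring

/-- A `p`-th power depends only on the reduction of its base, so `F (x ^ p) = F x ^ p = (x ^ p) ^ p`
and `δ (x ^ p)` vanishes. -/
theorem form_pow (x : T) : P.form D (x ^ p) = 0 := by
  have h : P.delta (x ^ p) = 0 := by
    rw [P.delta_eq (y := 0), map_zero]
    rw [map_pow, mul_zero, add_zero]
    exact P.pow_eq_pow (by rw [P.red_frob, map_pow])
  rw [form, h, map_zero, map_zero, map_pow, map_pow, derivation_pow_eq_zero p D, mul_zero,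
    add_zero]

/-- A different lift changes `δ` by a `p`-th power, which `D` kills. The form is thus a
Frobenius-linear derivation on `A` itself. -/
theorem form_congr {x y : T} (h : P.red x = P.red y) : P.form D x = P.form D y := by
  obtain ⟨z, hz⟩ := (P.red_eq_zero_iff (x - y)).1 (by rw [map_sub, h, sub_self])
  have hx : x = y + p * z := by rw [← hz]; ring
  have hz : P.form D (p * z) = 0 := by
    rw [form, P.red_natCast_mul, P.delta_natCast_mul, map_pow, derivation_pow_eq_zero p D,
      map_zero, map_zero, mul_zero, add_zero]
  rw [hx, form_add, hz, add_zero]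

/-- A derivation is horizontal if its pairings with the forms `a ^ (p - 1) da + d (δ x)` are
`p`-th powers. -/
def Horizontal (D : Derivation ℤ K K) : Prop := ∀ x : T, P.form D x ∈ pthPowers p K

/-- The elements whose form pairs to a `p`-th power with a given derivation. -/
def formSubsemiring : Subsemiring T where
  carrier := {x | P.form D x ∈ pthPowers p K}
  mul_mem' {x y} hx hy := by
    simp only [Set.mem_ofPred_eq, form_mul] at *
    exact add_mem (mul_mem (pow_mem_pthPowers p _) hy) (mul_mem (pow_mem_pthPowers p _) hx)
  one_mem' := by
    rw [Set.mem_ofPred_eq, ← one_pow p, form_pow]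
    exact zero_mem _
  add_mem' {x y} hx hy := by
    simp only [Set.mem_ofPred_eq, form_add] at *
    exact add_mem hx hy
  zero_mem' := by
    rw [Set.mem_ofPred_eq, ← zero_pow hp.out.ne_zero, form_pow]
    exact zero_mem _

theorem mem_formSubsemiring {x : T} : x ∈ P.formSubsemiring D ↔ P.form D x ∈ pthPowers p K :=
  Iff.rfl

theorem mem_formSubsemiring_of_pow_mul {s x : T} (hs : algebraMap A K (P.red s) ≠ 0)
    (h : s ^ p * x ∈ P.formSubsemiring D) : x ∈ P.formSubsemiring D := by
  rw [mem_formSubsemiring] at *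
  rw [form_mul, form_pow, mul_zero, add_zero] at h
  rw [map_pow, map_pow] at h
  have h1 := mul_mem (inv_mem (pow_mem_pthPowers p (algebraMap A K (P.red s) ^ p))) h
  rwa [inv_mul_cancel_left₀ (pow_ne_zero _ (pow_ne_zero _ hs))] at h1

/-- After multiplication by a suitable `s ^ p`, any element agrees modulo `p` with a polynomial in
the `ξ i` whose coefficients are `p`-th powers. The good elements form a subsemiring containing all
`p`-th powers, and the factor `s ^ p` can be cancelled. -/
theorem horizontal_of_pBasis [IsFractionRing A K] {ι : Type*} [Fintype ι]
    (ξ : ι → T) (h : IsPBasis p fun i => algebraMap A K (P.red (ξ i)))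
    (hξ : ∀ i, P.form D (ξ i) ∈ pthPowers p K) : P.Horizontal D := by
  classical
  intro x
  rw [← mem_formSubsemiring]
  choose u hu using fun α => (h.basis.repr (algebraMap A K (P.red x)) α).2
  -- The denominator `b` clears the `p`-th roots of the coordinates, so `b ^ p` clears the
  -- coordinates while keeping them `p`-th powers from `A`.
  obtain ⟨b, hb⟩ := IsLocalization.exist_integer_multiples_of_finset (nonZeroDivisors A)
    (Finset.univ.image u)
  choose w hw using fun α => hb (u α) (Finset.mem_image_of_mem u (Finset.mem_univ α))
  obtain ⟨s, hs⟩ := P.red_surjective b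
  choose v hv using fun α => P.red_surjective (w α)
  refine P.mem_formSubsemiring_of_pow_mul D (s := s) ?_ ?_
  · rw [hs]
    have : Nontrivial A := (algebraMap A K).domain_nontrivial
    exact IsLocalization.to_map_ne_zero_of_mem_nonZeroDivisors _ le_rfl b.2
  · have h1 : P.red (s ^ p * x) = P.red (∑ α, v α ^ p * ∏ i, ξ i ^ (α i).val) := by
      refine IsFractionRing.injective A K ?_
      rw [map_mul, map_mul, ← h.basis.sum_repr (algebraMap A K (P.red x)), map_sum, map_sum,
        Finset.mul_sum]
      refine Finset.sum_congr rfl fun α _ => ?_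
      rw [Subfield.smul_def, smul_eq_mul, ← hu α, frobenius_def]
      simp only [map_mul, map_pow, map_prod, hs, hv, hw, Algebra.smul_def, IsPBasis.basis_apply,
        pMonomial]
      ring
    rw [mem_formSubsemiring, P.form_congr D h1, ← mem_formSubsemiring]
    refine sum_mem fun α _ => mul_mem ?_ (prod_mem fun i _ =>
      pow_mem ((P.mem_formSubsemiring D).2 (hξ i)) _)
    rw [mem_formSubsemiring, form_pow]
    exact zero_mem _

end Form

section Canonical

variable {p : ℕ} [hp : Fact p.Prime] {A T : Type*} [CommRing A] [CommRing T]
  (P : FrobeniusThickening p A T)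

/-- An additive map inverse to Frobenius-linear scalars that kills the image of every horizontal
derivation. -/
structure IsCanonical (K : Type*) [Field K] [CharP K p] [Algebra A K] (τ : K →+ K) : Prop where
  map_one : τ 1 = 1
  map_pow_mul (z w : K) : τ (z ^ p * w) = z * τ w
  map_derivation (D : Derivation ℤ K K) (hD : P.Horizontal D) (w : K) : τ (D w) = 0

variable {P} {K : Type*} [Field K] [CharP K p] [Algebra A K]

theorem IsCanonical.congr {τ : K →+ K} (hτ : P.IsCanonical K τ) {K' : Type*} [Field K']
    [CharP K' p] [Algebra A K'] (e : K ≃ₐ[A] K') :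
    P.IsCanonical K' ((e : K →+ K').comp (τ.comp (e.symm : K' →+ K))) := by
  refine ⟨?_, fun z w => ?_, fun D hD w => ?_⟩
  · simp [hτ.map_one]
  · simp [hτ.map_pow_mul]
  · let D' : Derivation ℤ K K := Derivation.mk'
      ((e.symm : K' →+ K).comp ((D : K' →+ K').comp (e : K →+ K'))).toIntLinearMap fun a b => by
        simp [Derivation.leibniz]
    have hD' (a : K) : D' a = e.symm (D (e a)) := rfl
    have : P.Horizontal D' := fun x => by
      obtain ⟨z, hz⟩ := hD x
      refine ⟨e.symm z, ?_⟩
      rw [frobenius_def] at hz ⊢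
      rw [← map_pow, hz, form, form, hD', hD']
      simp
    have := hτ.map_derivation D' this (e.symm w)
    rw [hD', AlgEquiv.apply_symm_apply] at this
    change e (τ (e.symm (D w))) = 0
    rw [this, map_zero]

/-- The linear form with values in `p`-th powers attached to a canonical splitting. -/
def IsCanonical.linearMap {τ : K →+ K} (hτ : P.IsCanonical K τ) :
    K →ₗ[pthPowers p K] pthPowers p K where
  toFun w := ⟨τ w ^ p, pow_mem_pthPowers p _⟩
  map_add' a b := Subtype.ext (by simp [add_pow_char])
  map_smul' c a := Subtype.ext (by
    obtain ⟨_, z, rfl⟩ := c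
    simp [Subfield.smul_def, frobenius_def, hτ.map_pow_mul, mul_pow])

theorem IsCanonical.coe_linearMap {τ : K →+ K} (hτ : P.IsCanonical K τ) (w : K) :
    (hτ.linearMap w : K) = τ w ^ p := rfl

/-- Regard a derivation over the integers as linear over the subfield of `p`-th powers. -/
def derivationPthPowers (D : Derivation ℤ K K) : Derivation (pthPowers p K) K K :=
  Derivation.mk'
    { toFun := D
      map_add' := D.map_add
      map_smul' := by
        rintro ⟨_, z, rfl⟩ a
        simp [Subfield.smul_def, frobenius_def, derivation_pow_eq_zero p D] }
    D.leibniz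

variable {ι : Type*} [Fintype ι] [DecidableEq ι] {ξ : ι → T}
  (h : IsPBasis p fun i => algebraMap A K (P.red (ξ i)))

/-- The logarithmic potentials of a family of elements. -/
def potential (P : FrobeniusThickening p A T) (K : Type*) [Field K] [Algebra A K] {ι : Type*}
    (ξ : ι → T) (i : ι) : K :=
  algebraMap A K (P.delta (ξ i)) / algebraMap A K (P.red (ξ i)) ^ p

-- Since `p`-th powers are constants, `d (δ) = x ^ p * d (δ / x ^ p)`; this brings the form into
-- logarithmic shape.
omit [DecidableEq ι] in
include h in
theorem form_eq_of_pBasis (D : Derivation ℤ K K) (i : ι) :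
    P.form D (ξ i) = algebraMap A K (P.red (ξ i)) ^ p *
      (D (algebraMap A K (P.red (ξ i))) / algebraMap A K (P.red (ξ i)) +
        D (P.potential K ξ i)) := by
  have h0 := h.ne_zero i
  have h1 : D (algebraMap A K (P.delta (ξ i))) =
      algebraMap A K (P.red (ξ i)) ^ p * D (P.potential K ξ i) := by
    have : algebraMap A K (P.delta (ξ i)) =
        algebraMap A K (P.red (ξ i)) ^ p * P.potential K ξ i := by
      rw [potential]; field_simp
    rw [this, Derivation.leibniz, derivation_pow_eq_zero p D, smul_zero, add_zero, smul_eq_mul]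
  rw [form, h1, mul_add]
  congr 1
  rw [← mul_pow_sub_one hp.out.ne_zero]
  field_simp

/-- The splitting of the fraction field attached to a `p`-basis consisting of reductions. -/
def splittingOfPBasis : K →+ K :=
  (pthRoot p K).comp (h.splitting (P.potential K ξ)).toAddMonoidHom

theorem splittingOfPBasis_pow (w : K) :
    splittingOfPBasis h w ^ p = h.splitting (P.potential K ξ) w :=
  pthRoot_pow p _

theorem isCanonical_splittingOfPBasis : P.IsCanonical K (splittingOfPBasis h) := by
  refine ⟨?_, fun z w => ?_, fun D hD w => ?_⟩ <;> refine (frobenius_inj K p) ?_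
  · rw [frobenius_def, splittingOfPBasis_pow, IsPBasis.splitting_one]; simp
  · rw [frobenius_def, frobenius_def, mul_pow, splittingOfPBasis_pow, splittingOfPBasis_pow]
    have : z ^ p * w = (⟨z ^ p, pow_mem_pthPowers p z⟩ : pthPowers p K) • w := rfl
    rw [this, map_smul]
    rfl
  · rw [frobenius_def, splittingOfPBasis_pow, map_zero]
    have h1 := h.splitting_derivation (P.potential K ξ) (derivationPthPowers D) (fun i => by
      have h2 := hD (ξ i)
      rw [form_eq_of_pBasis h] at h2
      have h3 := mul_mem (inv_mem (pow_mem_pthPowers p (algebraMap A K (P.red (ξ i))))) h2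
      rwa [inv_mul_cancel_left₀ (pow_ne_zero _ (h.ne_zero i))] at h3) w
    exact congrArg Subtype.val h1

/-- The dual derivations pair to `0` or `1` with the forms of the `p`-basis, hence are horizontal
and `τ` kills their images; `eq_splitting` then applies. Canonical splittings are therefore unique.
-/
theorem IsCanonical.eq_splittingOfPBasis [IsFractionRing A K] {τ : K →+ K}
    (hτ : P.IsCanonical K τ) : τ = splittingOfPBasis h := by
  have h1 := h.eq_splitting (P.potential K ξ) hτ.linearMap
    (Subtype.ext (by rw [hτ.coe_linearMap, hτ.map_one, one_pow]; rfl)) (fun i f => by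
      refine Subtype.ext ?_
      rw [hτ.coe_linearMap]
      have := hτ.map_derivation ((h.dualDerivation (P.potential K ξ) i).restrictScalars ℤ)
        (P.horizontal_of_pBasis _ ξ h fun l => by
          rw [form_eq_of_pBasis h]
          refine mul_mem (pow_mem_pthPowers p _) ?_
          have h2 := h.dualDerivation_pairing (P.potential K ξ) i l
          refine (congrArg (· ∈ pthPowers p K) h2).mpr ?_
          split_ifs
          · exact one_mem _
          · exact zero_mem _) f
      change τ (h.dualDerivation (P.potential K ξ) i f) = 0 at this
      rw [this, zero_pow hp.out.ne_zero]; rfl)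
  ext w
  refine (frobenius_inj K p) ?_
  rw [frobenius_def, frobenius_def, splittingOfPBasis_pow, ← h1, hτ.coe_linearMap]

end Canonical

end FrobeniusThickening

/-! ### Integrality of the splitting in adapted coordinates -/

namespace IsPBasis

variable {p : ℕ} [hp : Fact p.Prime] {K ι : Type*} [Field K] [CharP K p] [Fintype ι]
  [DecidableEq ι] {x : ι → K} (h : IsPBasis p x)

section Integrality

variable {S : Subring K} (hx : ∀ i, x i ∈ S)
  (hS : ∀ f ∈ S, ∀ α, (h.basis.repr f α : K) ∈ S)

include hx hS

-- The quotient `s` is the partial derivative `∂f/∂x j`: a monomial that the Euler derivation does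
-- not kill contains `x j`, and the coordinates of `f` stay in `S`.
omit [DecidableEq ι] in
theorem exists_euler_eq_mul (j : ι) {f : K} (hf : f ∈ S) : ∃ s ∈ S, h.euler j f = x j * s := by
  classical
  have hα (α : ι → ZMod p) : ∃ s ∈ S, h.euler j (h.basis α) = x j * s := by
    rw [basis_apply, euler_pMonomial]
    by_cases h0 : α j = 0
    · exact ⟨0, zero_mem _, by simp [h0]⟩
    · refine ⟨ZMod.castHom (dvd_refl p) K (α j) * (x j ^ ((α j).val - 1) *
        ∏ i ∈ Finset.univ.erase j, x i ^ (α i).val), mul_mem ?_ (mul_mem (pow_mem (hx j) _)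
          (prod_mem fun i _ => pow_mem (hx i) _)), ?_⟩
      · rw [← ZMod.natCast_zmod_val (α j), map_natCast]
        exact natCast_mem _ _
      · rw [pMonomial, ← Finset.mul_prod_erase _ _ (Finset.mem_univ j),
          ← mul_pow_sub_one ((ZMod.val_ne_zero _).2 h0)]
        ring
  choose s hs hs' using hα
  refine ⟨∑ α, (h.basis.repr f α : K) * s α, sum_mem fun α _ => mul_mem (hS f hf α) (hs α), ?_⟩
  conv_lhs => rw [← h.basis.sum_repr f]
  rw [map_sum, Finset.mul_sum]
  refine Finset.sum_congr rfl fun α _ => ?_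
  rw [Derivation.map_smul, hs', Subfield.smul_def, smul_eq_mul]
  ring

-- Multiplication by the product of the `x i` raises all exponents by one, so only the monomial with
-- every exponent `p - 1`, indexed by `-1`, becomes constant. It contributes the full factor `(∏ x
-- i) ^ p`.
omit hx in
theorem exists_constCoeff_prod_mul {f : K} (hf : f ∈ S) :
    ∃ s ∈ S, (h.constCoeff ((∏ i, x i) * f) : K) = (∏ i, x i) ^ p * s := by
  have hval : (-1 : ZMod p).val = p - 1 := by
    obtain ⟨q, rfl⟩ : ∃ q, p = q + 1 := ⟨p - 1, (Nat.sub_add_cancel hp.out.one_le).symm⟩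
    exact ZMod.val_neg_one q
  have h1 : ∏ i, x i = pMonomial x (1 : ι → ZMod p) := by simp [pMonomial, ZMod.val_one]
  have hα (α : ι → ZMod p) : (h.constCoeff ((∏ i, x i) * h.basis α) : K) =
      (∏ i, x i) ^ p * if α = -1 then 1 else 0 := by
    obtain ⟨c, hc⟩ := pMonomial_mul p x 1 α
    rw [h1, basis_apply, hc, map_smul, constCoeff_pMonomial]
    have e : 1 + α = 0 ↔ α = -1 := by rw [add_comm, add_eq_zero_iff_eq_neg]
    simp only [e]
    split_ifs with hα
    · have h2 : (c : K) = pMonomial x (1 : ι → ZMod p) * pMonomial x α := by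
        rw [hc, e.2 hα, pMonomial_zero, Subfield.smul_def, smul_eq_mul, mul_one]
      rw [smul_eq_mul, mul_one, mul_one, h2, ← h1, hα, pMonomial, ← Finset.prod_mul_distrib,
        ← Finset.prod_pow]
      refine Finset.prod_congr rfl fun i _ => ?_
      rw [Pi.neg_apply, Pi.one_apply, hval, mul_pow_sub_one hp.out.ne_zero]
    · simp
  refine ⟨h.basis.repr f (-1), hS f hf _, ?_⟩
  conv_lhs => rw [← h.basis.sum_repr f]
  rw [Finset.mul_sum, map_sum, AddSubmonoidClass.coe_finsetSum, Finset.sum_eq_single (-1)]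
  · rw [mul_smul_comm, map_smul, smul_eq_mul, Subfield.coe_mul, hα, if_pos rfl]
    ring
  · intro α _ hne
    rw [mul_smul_comm, map_smul, smul_eq_mul, Subfield.coe_mul, hα, if_neg hne]
    ring
  · simp

/-- The logarithmic matrix is `diag (x ^ -p) * N * diag x` with `N` over `S`. Its determinant has
the pole `(∏ x i) ^ -p` and a factor `∏ x i`, and the constant coefficient turns the latter into `(∏
x i) ^ p`, cancelling the pole. -/
theorem splitting_mem (d : ι → K) (hd : ∀ i, d i ∈ S) {f : K} (hf : f ∈ S) :
    (h.splitting (fun i => d i / x i ^ p) f : K) ∈ S := by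
  choose s hs hs' using fun i j => h.exists_euler_eq_mul hx hS j (hd i)
  -- Row `i` holds the form `x i ^ (p - 1) dx i + d (d i)` in the basis `dx j`.
  let N : Matrix ι ι S := Matrix.of fun i j =>
    (if i = j then ⟨x i, hx i⟩ ^ (p - 1) else 0) + ⟨s i j, hs i j⟩
  have hN : h.logJacobian (fun i => d i / x i ^ p) =
      Matrix.diagonal (fun i => (x i ^ p)⁻¹) * S.subtype.mapMatrix N * Matrix.diagonal x := by
    ext i j
    rw [Matrix.mul_diagonal, Matrix.diagonal_mul, logJacobian_apply]
    have h1 : d i / x i ^ p = (⟨(x i ^ p)⁻¹, inv_mem (pow_mem_pthPowers p _)⟩ :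
        pthPowers p K) • d i := div_eq_inv_mul _ _
    rw [h1, Derivation.map_smul, hs', Subfield.smul_def, smul_eq_mul]
    have h2 : S.subtype.mapMatrix N i j = (if i = j then x i ^ (p - 1) else 0) + s i j := by
      change S.subtype (N i j) = _
      simp only [N, Matrix.of_apply, map_add]
      congr 1
      split_ifs <;> simp
    rw [h2]
    split_ifs with hij
    · subst hij
      have := h.ne_zero i
      have e1 : x i ^ (p - 1) * x i = x i ^ p := pow_sub_one_mul hp.out.ne_zero _
      have e2 : (x i ^ p)⁻¹ * x i ^ p = 1 := inv_mul_cancel₀ (pow_ne_zero _ this)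
      linear_combination -(x i ^ p)⁻¹ * e1 - e2
    · ring
  rw [splitting_apply, hN, Matrix.det_mul, Matrix.det_mul, Matrix.det_diagonal,
    Matrix.det_diagonal, ← RingHom.map_det, Finset.prod_inv_distrib, Finset.prod_pow]
  obtain ⟨c, hc, hc'⟩ := h.exists_constCoeff_prod_mul hS (mul_mem hf N.det.2)
  have h3 : f * (((∏ i, x i) ^ p)⁻¹ * S.subtype N.det * ∏ i, x i) =
      ((⟨((∏ i, x i) ^ p)⁻¹, inv_mem (pow_mem_pthPowers p _)⟩ : pthPowers p K) : K) *
        ((∏ i, x i) * (f * N.det)) := by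
    rw [Subring.subtype_apply]; ring
  rw [h3, constCoeff_smul_mul, Subfield.coe_mul, hc', inv_mul_cancel_left₀]
  · exact hc
  · exact pow_ne_zero _ (Finset.prod_ne_zero_iff.2 fun i _ => h.ne_zero i)

end Integrality

end IsPBasis

/-! ### Existence of finite `p`-bases -/

section ExistsPBasis

variable (p : ℕ) [hp : Fact p.Prime] {K : Type*} [Field K] [CharP K p]

theorem span_pMonomial {ι : Type*} [Fintype ι] (x : ι → K) :
    Submodule.span (pthPowers p K) (Set.range (pMonomial (p := p) x)) =
      Subalgebra.toSubmodule (Algebra.adjoin (pthPowers p K) (Set.range x)) := by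
  classical
  set W := Submodule.span (pthPowers p K) (Set.range (pMonomial (p := p) x))
  refine le_antisymm (Submodule.span_le.2 ?_) ?_
  · rintro _ ⟨α, rfl⟩
    exact Subalgebra.prod_mem _ fun i _ =>
      Subalgebra.pow_mem _ (Algebra.subset_adjoin (Set.mem_range_self i)) _
  · have hmul (a b : K) (ha : a ∈ W) (hb : b ∈ W) : a * b ∈ W := by
      have h1 : W * W ≤ W := by
        rw [Submodule.span_mul_span, Submodule.span_le]
        rintro _ ⟨_, ⟨α, rfl⟩, _, ⟨β, rfl⟩, rfl⟩
        obtain ⟨c, hc⟩ := pMonomial_mul p x α β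
        change pMonomial x α * pMonomial x β ∈ W
        rw [hc]
        exact W.smul_mem _ (Submodule.subset_span ⟨_, rfl⟩)
      exact h1 (Submodule.mul_mem_mul ha hb)
    have hone : (1 : K) ∈ W := Submodule.subset_span ⟨0, pMonomial_zero x⟩
    intro a ha
    refine Algebra.adjoin_induction (p := fun a _ => a ∈ W) ?_ ?_ (fun _ _ _ _ => W.add_mem)
      (fun a b _ _ => hmul a b) ha
    · rintro _ ⟨i, rfl⟩
      exact Submodule.subset_span ⟨_, pMonomial_single p x i⟩
    · intro c
      rw [Algebra.algebraMap_eq_smul_one]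
      exact W.smul_mem _ hone

theorem isIntegral_pthPowers (z : K) : IsIntegral (pthPowers p K) z := by
  refine ⟨Polynomial.X ^ p - Polynomial.C ⟨z ^ p, pow_mem_pthPowers p z⟩,
    Polynomial.monic_X_pow_sub_C _ hp.out.ne_zero, ?_⟩
  simp [Polynomial.eval₂_sub]
  exact sub_self _

instance : Algebra.IsAlgebraic (pthPowers p K) K :=
  ⟨fun z => (isIntegral_pthPowers p z).isAlgebraic⟩

/-- The algebra generated by `x` is a field `E`, as `K` is algebraic over its `p`-th powers. Since
`p`-th roots are unique and `g ∉ E`, the polynomial `X ^ p - g ^ p` is irreducible over `E`, so the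
powers of `g` below `p` are independent over `E`. -/
theorem linearIndependent_pMonomial_option {ι : Type*} [Fintype ι] {x : ι → K}
    (hx : LinearIndependent (pthPowers p K) (pMonomial (p := p) x)) {g : K}
    (hg : g ∉ Algebra.adjoin (pthPowers p K) (Set.range x)) :
    LinearIndependent (pthPowers p K)
      (pMonomial (p := p) (fun i : Option ι => i.elim g x)) := by
  set E := IntermediateField.adjoin (pthPowers p K) (Set.range x) with hE
  have hE' : E.toSubalgebra = Algebra.adjoin (pthPowers p K) (Set.range x) :=
    IntermediateField.adjoin_toSubalgebra_of_isAlgebraic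
      fun z _ => Algebra.IsAlgebraic.isAlgebraic z
  have hgE : g ∉ E := fun h => hg (hE' ▸ h)
  have hgp : g ^ p ∈ E := E.algebraMap_mem ⟨g ^ p, pow_mem_pthPowers p g⟩
  have hirr : Irreducible (Polynomial.X ^ p - Polynomial.C (⟨g ^ p, hgp⟩ : E)) := by
    refine X_pow_sub_C_irreducible_of_prime hp.out fun b hb => hgE ?_
    have h1 : (b : K) ^ p = g ^ p := congrArg Subtype.val hb
    have h2 : (b : K) = g := frobenius_inj K p h1
    exact h2 ▸ b.2
  have hmin : Polynomial.X ^ p - Polynomial.C (⟨g ^ p, hgp⟩ : E) = minpoly E g := by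
    refine minpoly.eq_of_irreducible_of_monic hirr ?_
      (Polynomial.monic_X_pow_sub_C _ hp.out.ne_zero)
    simp only [map_sub, map_pow, Polynomial.aeval_X, Polynomial.aeval_C]
    exact sub_self _
  have hdeg : (minpoly E g).natDegree = p := by
    rw [← hmin, Polynomial.natDegree_X_pow_sub_C]
  have hc := linearIndependent_pow (K := E) g
  rw [hdeg] at hc
  have hmem (α : ι → ZMod p) : pMonomial x α ∈ E :=
    prod_mem fun i _ => pow_mem (IntermediateField.subset_adjoin _ _ (Set.mem_range_self i)) _
  have hb : LinearIndependent (pthPowers p K) fun α : ι → ZMod p => (⟨pMonomial x α, hmem α⟩ : E) :=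
    LinearIndependent.of_comp E.val.toLinearMap hx
  have hprod := linearIndependent_smul hb hc
  let e (γ : Option ι → ZMod p) : (ι → ZMod p) × Fin p :=
    (fun i => γ (some i), ⟨(γ none).val, ZMod.val_lt _⟩)
  have he : Function.Injective e := by
    intro γ γ' h
    ext i
    rcases i with _ | i
    · exact ZMod.val_injective p (congrArg (fun a => (a.2 : ℕ)) h)
    · exact congrFun (congrArg Prod.fst h) i
  convert hprod.comp e he using 1
  ext γ
  simp only [pMonomial, Fintype.prod_option, Function.comp_apply, e, Option.elim]
  exact mul_comm _ _

theorem exists_isPBasis {G : Set K} (hG : G.Finite)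
    (h : Algebra.adjoin (pthPowers p K) G = ⊤) :
    ∃ (n : Type) (_ : Fintype n) (x : n → K), IsPBasis p x ∧ ∀ i, x i ∈ G := by
  have key (s : Finset K) (hs : (s : Set K) ⊆ G) : ∃ (n : Type) (_ : Fintype n) (x : n → K),
      LinearIndependent (pthPowers p K) (pMonomial (p := p) x) ∧ (∀ i, x i ∈ G) ∧
        (s : Set K) ⊆ Algebra.adjoin (pthPowers p K) (Set.range x) := by
    classical
    induction s using Finset.induction_on with
    | empty =>
      refine ⟨Empty, inferInstance, Empty.elim, ?_, fun i => i.elim, by simp⟩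
      refine LinearIndependent.of_subsingleton (default : Empty → ZMod p) ?_
      simp [pMonomial]
    | insert g s _ ih =>
      obtain ⟨n, _, x, hx, hxG, hsx⟩ := ih fun a ha => hs (by simp [Finset.mem_coe.1 ha])
      by_cases hg : g ∈ Algebra.adjoin (pthPowers p K) (Set.range x)
      · refine ⟨n, inferInstance, x, hx, hxG, ?_⟩
        rw [Finset.coe_insert, Set.insert_subset_iff]
        exact ⟨hg, hsx⟩
      · refine ⟨Option n, inferInstance, fun i => i.elim g x,
          linearIndependent_pMonomial_option p hx hg, ?_, ?_⟩
        · rintro (_ | i)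
          · exact hs (by simp)
          · exact hxG i
        · rw [Finset.coe_insert, Set.insert_subset_iff]
          refine ⟨Algebra.subset_adjoin ⟨none, rfl⟩, hsx.trans (Algebra.adjoin_mono ?_)⟩
          rintro _ ⟨i, rfl⟩
          exact ⟨some i, rfl⟩
  obtain ⟨n, _, x, hx, hxG, hsx⟩ := key hG.toFinset (by simp)
  refine ⟨n, inferInstance, x, ⟨hx, ?_⟩, hxG⟩
  rw [span_pMonomial, top_le_iff, Algebra.toSubmodule_eq_top, ← top_le_iff, ← h]
  refine Algebra.adjoin_le ?_
  simpa using hsx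

end ExistsPBasis

/-! ### Rings generated by `p`-th powers and a finite set -/

section FrobeniusFinite

/-- A ring is generated by `p`-th powers and the elements of a set. -/
def FrobeniusGenerated (p : ℕ) {A : Type*} [CommRing A] (G : Set A) : Prop :=
  Subring.closure (Set.range (fun a : A => a ^ p) ∪ G) = ⊤

theorem FrobeniusGenerated.map {p : ℕ} {A B : Type*} [CommRing A] [CommRing B] {G : Set A}
    (h : FrobeniusGenerated p G) (f : A →+* B) (hf : ∀ b, ∃ a c, b = f a * c ^ p) :
    FrobeniusGenerated p (f '' G) := by
  rw [FrobeniusGenerated, eq_top_iff]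
  rintro b -
  obtain ⟨a, c, rfl⟩ := hf b
  refine mul_mem ?_ (Subring.subset_closure (Or.inl ⟨c, rfl⟩))
  have ha : a ∈ Subring.closure (Set.range (fun a : A => a ^ p) ∪ G) := by
    rw [FrobeniusGenerated] at h; rw [h]; trivial
  have h1 : Subring.closure (Set.range (fun a : A => a ^ p) ∪ G) ≤
      (Subring.closure (Set.range (fun a : B => a ^ p) ∪ f '' G)).comap f := by
    rw [Subring.closure_le]
    rintro _ (⟨a, rfl⟩ | ha)
    · exact Subring.subset_closure (Or.inl ⟨f a, (map_pow f a p).symm⟩)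
    · exact Subring.subset_closure (Or.inr ⟨_, ha, rfl⟩)
  exact h1 ha

/-- Fractions cost no new generators, because `a / s = a * s ^ (p - 1) * (1 / s) ^ p`. -/
theorem FrobeniusGenerated.of_isLocalization {p : ℕ} [hp : Fact p.Prime] {A B : Type*} [CommRing A]
    [CommRing B] [Algebra A B] {G : Set A} (h : FrobeniusGenerated p G) (M : Submonoid A)
    [IsLocalization M B] : FrobeniusGenerated p (algebraMap A B '' G) := by
  refine h.map _ fun b => ?_
  obtain ⟨a, s, rfl⟩ := IsLocalization.exists_mk'_eq M b
  refine ⟨a * s ^ (p - 1), IsLocalization.mk' B 1 s, ?_⟩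
  rw [← IsLocalization.mk'_pow, one_pow, IsLocalization.mk'_eq_mul_mk'_one a s, map_mul,
    mul_assoc]
  congr 1
  refine IsLocalization.mk'_eq_iff_eq_mul.2 ?_
  have h1 := IsLocalization.mk'_spec B (1 : A) (s ^ p)
  have h2 : ((s ^ p : M) : A) = (s : A) ^ (p - 1) * s := by
    rw [pow_sub_one_mul hp.out.ne_zero, SubmonoidClass.coe_pow]
  rw [h2, map_mul] at h1
  rw [← h1]
  ring

theorem FrobeniusGenerated.adjoin_eq_top {p : ℕ} {A : Type*} [CommRing A] {G : Set A}
    (h : FrobeniusGenerated p G) (S : Type*) [CommRing S] [Algebra S A]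
    (hS : ∀ a : A, a ^ p ∈ (algebraMap S A).range) : Algebra.adjoin S G = ⊤ := by
  rw [eq_top_iff]
  intro a _
  have ha : a ∈ Subring.closure (Set.range (fun a : A => a ^ p) ∪ G) := by
    rw [FrobeniusGenerated] at h; rw [h]; trivial
  have h1 : Subring.closure (Set.range (fun a : A => a ^ p) ∪ G) ≤
      (Algebra.adjoin S G).toSubring := by
    rw [Subring.closure_le]
    rintro _ (⟨a, rfl⟩ | ha)
    · obtain ⟨s, hs⟩ := hS a
      have := (Algebra.adjoin S G).algebraMap_mem s
      rwa [hs] at this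
    · exact Algebra.subset_adjoin ha
  exact h1 ha

theorem FrobeniusGenerated.finite {p : ℕ} [hp : Fact p.Prime] {A : Type*} [CommRing A] {G : Set A}
    (h : FrobeniusGenerated p G) (hG : G.Finite) (S : Type*) [CommRing S] [Algebra S A]
    (hS : ∀ a : A, a ^ p ∈ (algebraMap S A).range) : Module.Finite S A := by
  have h1 := Algebra.finite_adjoin_of_finite_of_isIntegral (R := S) hG fun a _ => by
    obtain ⟨s, hs⟩ := hS a
    refine ⟨Polynomial.X ^ p - Polynomial.C s, Polynomial.monic_X_pow_sub_C _ hp.out.ne_zero, ?_⟩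
    simp [Polynomial.eval₂_sub, hs]
  rw [h.adjoin_eq_top S hS] at h1
  exact Module.Finite.equiv Subalgebra.topEquiv.toLinearEquiv

theorem FrobeniusGenerated.exists_isPBasis {p : ℕ} [hp : Fact p.Prime] {A K : Type*} [CommRing A]
    [Field K] [CharP K p] {G : Set A} (hG : G.Finite) (f : A →+* K)
    (h : FrobeniusGenerated p (f '' G)) :
    ∃ (n : Type) (_ : Fintype n) (x : n → A), IsPBasis p fun i => f (x i) := by
  obtain ⟨n, hn, x, hx, hxG⟩ := FrobLift.exists_isPBasis p (hG.image f)
    (h.adjoin_eq_top (pthPowers p K) fun a => ⟨⟨_, pow_mem_pthPowers p a⟩, rfl⟩)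
  choose y hy using hxG
  refine ⟨n, hn, y, ?_⟩
  have : (fun i => f (y i)) = x := funext fun i => (hy i).2
  rwa [this]

end FrobeniusFinite

/-! ### `p`-bases adapted to a discrete valuation ring -/

section DVR

/-- The family obtained by adjoining one element. -/
abbrev consFamily {R ι : Type*} (t : R) (y : ι → R) (i : Option ι) : R := i.elim t y

theorem pMonomial_consFamily {p : ℕ} {R ι : Type*} [CommRing R] [Fintype ι]
    (t : R) (y : ι → R) (γ : Option ι → ZMod p) :
    pMonomial (consFamily t y) γ = t ^ (γ none).val * pMonomial y (fun i => γ (some i)) := by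
  simp [pMonomial, Fintype.prod_option]

theorem map_pMonomial {p : ℕ} {ι A B : Type*} [CommRing A] [CommRing B] [Fintype ι]
    (f : A →+* B) (y : ι → A)
    (α : ι → ZMod p) : f (pMonomial y α) = pMonomial (fun i => f (y i)) α := by
  simp [pMonomial]


variable {p : ℕ} [hp : Fact p.Prime] {R : Type*} [CommRing R] [IsDomain R]
  {κ : Type*} [Field κ] [CharP κ p] {ι : Type*} [Fintype ι] [DecidableEq ι]
  {y : ι → R} {t : R} (ρ : R →+* κ)

include ρ in
/-- If the reductions of `y` form a `p`-basis of the residue field and a combination of monomials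
with `p`-th powers of coefficients is divisible by `t ^ p`, all coefficients are divisible by the
uniformizer `t`. -/
theorem dvd_of_pow_dvd_sum (ht : t ≠ 0) (hρ : ∀ r, ρ r = 0 ↔ t ∣ r)
    (hy : IsPBasis p fun i => ρ (y i)) (z : (Option ι → ZMod p) → R)
    (hz : t ^ p ∣ ∑ γ, z γ ^ p * pMonomial (consFamily t y) γ) (γ : Option ι → ZMod p) :
    t ∣ z γ := by
  classical
  -- Induction on the exponent `j` of `t`. Modulo `t ^ (j + 1)`, terms of smaller exponent vanish
  -- since `t ^ p` divides `z γ ^ p`, and terms of larger exponent vanish outright. Dividing the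
  -- rest by `t ^ j` leaves a relation among the monomials of the residue field.
  have key (j : ℕ) : ∀ γ : Option ι → ZMod p, (γ none).val = j → t ∣ z γ := by
    induction j using Nat.strong_induction_on with
    | _ j ih =>
      intro γ₀ hγ₀
      have hj : j < p := hγ₀ ▸ ZMod.val_lt _
      let u : Option ι → ZMod p := γ₀
      have h1 : t ^ (j + 1) ∣ ∑ γ, z γ ^ p * pMonomial (consFamily t y) γ :=
        (pow_dvd_pow t hj).trans hz
      rw [← Finset.sum_filter_add_sum_filter_not Finset.univ
        (fun γ : Option ι → ZMod p => (γ none).val = j)] at h1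
      have h2 : t ^ (j + 1) ∣ ∑ γ with ¬ (γ none).val = j,
          z γ ^ p * pMonomial (consFamily t y) γ := by
        refine Finset.dvd_sum fun γ hγ => ?_
        rw [Finset.mem_filter] at hγ
        rcases lt_or_gt_of_ne hγ.2 with h | h
        · exact Dvd.dvd.mul_right ((pow_dvd_pow t hj).trans (pow_dvd_pow_of_dvd (ih _ h γ rfl) p)) _
        · rw [pMonomial_consFamily]
          exact Dvd.dvd.mul_left (Dvd.dvd.mul_right (pow_dvd_pow t h) _) _
      rw [dvd_add_left h2] at h1
      let e (β : ι → ZMod p) (i : Option ι) : ZMod p := i.elim (γ₀ none) β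
      have h3 : ∑ γ with (γ none).val = j, z γ ^ p * pMonomial (consFamily t y) γ =
          t ^ j * ∑ β : ι → ZMod p, z (e β) ^ p * pMonomial y β := by
        rw [Finset.mul_sum]
        refine Finset.sum_bij' (fun γ _ i => γ (some i)) (fun β _ => e β) (by simp)
          (fun β _ => by simp [e, hγ₀]) (fun γ hγ => ?_) (fun β _ => rfl) (fun γ hγ => ?_)
        · funext i
          rcases i with _ | i
          · rw [Finset.mem_filter] at hγ
            exact ZMod.val_injective p (hγ₀.trans hγ.2.symm)
          · rfl
        · have : e (fun i => γ (some i)) = γ := by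
            funext i
            rcases i with _ | i
            · rw [Finset.mem_filter] at hγ
              exact ZMod.val_injective p (hγ₀.trans hγ.2.symm)
            · rfl
          rw [this, pMonomial_consFamily]
          rw [Finset.mem_filter] at hγ
          rw [hγ.2]
          ring
      rw [h3, pow_succ, mul_dvd_mul_iff_left (pow_ne_zero _ ht), ← hρ, map_sum] at h1
      have h4 : ∑ β : ι → ZMod p, (⟨ρ (z (e β)) ^ p, pow_mem_pthPowers p _⟩ : pthPowers p κ) •
          pMonomial (fun i => ρ (y i)) β = 0 := by
        rw [← h1]
        refine Finset.sum_congr rfl fun β _ => ?_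
        rw [map_mul, map_pow, map_pMonomial]
        rfl
      have h5 := Fintype.linearIndependent_iff.1 hy.linearIndependent _ h4
        (fun i => γ₀ (some i))
      have h6 : ρ (z (e fun i => γ₀ (some i))) ^ p = 0 := congrArg Subtype.val h5
      have h7 : e (fun i => γ₀ (some i)) = γ₀ := by
        funext i
        rcases i with _ | i <;> rfl
      rw [h7] at h6
      exact (hρ _).1 (pow_eq_zero_iff hp.out.ne_zero |>.1 h6)
  exact key _ γ rfl

include ρ in
theorem pow_dvd_of_pow_dvd_sum (ht : t ≠ 0) (hρ : ∀ r, ρ r = 0 ↔ t ∣ r)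
    (hy : IsPBasis p fun i => ρ (y i)) (n : ℕ) (z : (Option ι → ZMod p) → R)
    (hz : t ^ (p * n) ∣ ∑ γ, z γ ^ p * pMonomial (consFamily t y) γ) (γ : Option ι → ZMod p) :
    t ^ n ∣ z γ := by
  induction n generalizing z with
  | zero => simp
  | succ n ih =>
    have h1 := dvd_of_pow_dvd_sum ρ ht hρ hy z ((pow_dvd_pow t (Nat.le_mul_of_pos_right p
      (Nat.succ_pos n))).trans hz)
    choose w hw using h1
    have h2 : ∑ γ, z γ ^ p * pMonomial (consFamily t y) γ =
        t ^ p * ∑ γ, w γ ^ p * pMonomial (consFamily t y) γ := by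
      rw [Finset.mul_sum]
      refine Finset.sum_congr rfl fun γ _ => ?_
      rw [hw γ]; ring
    rw [h2, mul_add, mul_one, add_comm, pow_add, mul_dvd_mul_iff_left (pow_ne_zero _ ht)] at hz
    rw [hw γ, pow_succ']
    exact mul_dvd_mul_left t (ih w hz)

variable {K : Type*} [Field K] [Algebra R K] [IsFractionRing R K]

-- A common denominator is a unit times `t ^ n`. Its `p`-th power puts a factor `t ^ (p * n)` into
-- the sum, which forces `t ^ n` into every numerator.
include ρ in
theorem mem_range_of_sum_mem_range (ht : Irreducible t) [IsDiscreteValuationRing R]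
    (hρ : ∀ r, ρ r = 0 ↔ t ∣ r) (hy : IsPBasis p fun i => ρ (y i))
    (c : (Option ι → ZMod p) → K)
    (hc : ∑ γ, c γ ^ p * pMonomial (fun i => algebraMap R K (consFamily t y i)) γ ∈
      (algebraMap R K).range) (γ : Option ι → ZMod p) : c γ ∈ (algebraMap R K).range := by
  classical
  obtain ⟨r, hr⟩ := hc
  obtain ⟨b, hb⟩ := IsLocalization.exist_integer_multiples_of_finset (nonZeroDivisors R)
    (Finset.univ.image c)
  choose w hw using fun γ => hb (c γ) (Finset.mem_image_of_mem c (Finset.mem_univ γ))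
  have hb0 : (b : R) ≠ 0 := nonZeroDivisors.ne_zero b.2
  obtain ⟨n, v, hv⟩ := IsDiscreteValuationRing.eq_unit_mul_pow_irreducible hb0 ht
  have h1 : ∑ γ, w γ ^ p * pMonomial (consFamily t y) γ = (b : R) ^ p * r := by
    refine IsFractionRing.injective R K ?_
    rw [map_mul, hr, Finset.mul_sum, map_sum]
    refine Finset.sum_congr rfl fun γ _ => ?_
    rw [map_mul, map_pow, hw, map_pMonomial, Algebra.smul_def, map_pow]
    ring
  have h2 : t ^ (p * n) ∣ ∑ γ, w γ ^ p * pMonomial (consFamily t y) γ := by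
    rw [h1, hv, mul_pow, ← pow_mul, mul_comm n p, mul_assoc, mul_left_comm]
    exact dvd_mul_right _ _
  obtain ⟨s, hs⟩ := pow_dvd_of_pow_dvd_sum ρ ht.ne_zero hρ hy n w h2 γ
  refine ⟨(v⁻¹ : Rˣ) * s, ?_⟩
  have h3 : (b : R) * ((v⁻¹ : Rˣ) * s) = w γ := by
    rw [hv, hs, mul_comm (v : R), mul_assoc, Units.mul_inv_cancel_left]
  have h4 := hw γ
  rw [← h3, Algebra.smul_def, map_mul] at h4
  exact mul_left_cancel₀ ((map_ne_zero_iff _ (IsFractionRing.injective R K)).2 hb0) h4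

omit [IsDomain R] in
-- Successive `t`-adic approximation using the `p`-basis of the residue field. It stops at `m = p`,
-- where the exponent of `t` leaves the allowed range and `t ^ p` is a scalar.
include ρ in
theorem exists_sum_eq_add (hρ' : Function.Surjective ρ) (hρ : ∀ r, ρ r = 0 ↔ t ∣ r)
    (hy : IsPBasis p fun i => ρ (y i)) (S : Subring R) (hS : ∀ a : R, a ^ p ∈ S) (m : ℕ)
    (hm : m ≤ p) (f : R) :
    ∃ a ∈ Submodule.span S (Set.range (pMonomial (p := p) (consFamily t y))), ∃ r,
      f = a + t ^ m * r := by
  induction m with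
  | zero => exact ⟨0, zero_mem _, f, by simp⟩
  | succ m ih =>
    obtain ⟨a, ha, r, hr⟩ := ih (by omega)
    choose c hc using fun β => (hy.basis.repr (ρ r) β).2
    choose z hz using fun β => hρ' (c β)
    have h1 : ρ (r - ∑ β, z β ^ p * pMonomial y β) = 0 := by
      rw [map_sub, map_sum, sub_eq_zero]
      conv_lhs => rw [← hy.basis.sum_repr (ρ r)]
      refine Finset.sum_congr rfl fun β _ => ?_
      rw [map_mul, map_pow, map_pMonomial, hz, Subfield.smul_def, smul_eq_mul, ← hc,
        IsPBasis.basis_apply]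
      rfl
    obtain ⟨s, hs⟩ := (hρ _).1 h1
    refine ⟨a + ∑ β, (⟨z β ^ p, hS _⟩ : S) • (t ^ m * pMonomial y β),
      add_mem ha (sum_mem fun β _ => Submodule.smul_mem _ _ (Submodule.subset_span ?_)), s, ?_⟩
    · refine ⟨fun i => i.elim (m : ZMod p) β, ?_⟩
      rw [pMonomial_consFamily]
      simp [ZMod.val_natCast_of_lt (show m < p by omega)]
    · rw [hr, add_assoc]
      congr 1
      have h2 : r = ∑ β, z β ^ p * pMonomial y β + t * s := by rw [← hs]; ring
      conv_lhs => rw [h2, mul_add, Finset.mul_sum]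
      congr 1
      · refine Finset.sum_congr rfl fun β _ => ?_
        rw [Subring.smul_def, smul_eq_mul]; ring
      · ring

omit [IsDomain R] in
-- Nakayama's lemma over the ring of `p`-th powers, for the ideal generated by `t ^ p`. That ideal
-- lies in the Jacobson radical because `1 + t ^ p * a ^ p` is the Frobenius image of the unit `1 +
-- t * a`.
include ρ in
theorem span_consFamily_eq_top [IsLocalRing R] (ht : ¬ IsUnit t)
    (hρ' : Function.Surjective ρ) (hρ : ∀ r, ρ r = 0 ↔ t ∣ r)
    (hy : IsPBasis p fun i => ρ (y i)) [CharP R p] [Module.Finite (frobenius R p).range R] :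
    Submodule.span (frobenius R p).range (Set.range (pMonomial (p := p) (consFamily t y))) = ⊤ := by
  set S := (frobenius R p).range
  have hS (a : R) : a ^ p ∈ S := ⟨a, rfl⟩
  rw [eq_top_iff]
  refine Submodule.le_of_le_smul_of_le_jacobson_bot (I := Ideal.span {(⟨t ^ p, hS t⟩ : S)})
    Module.Finite.fg_top ?_ ?_
  · rw [Ideal.span_singleton_le_iff_mem, Ideal.mem_jacobson_bot]
    rintro ⟨_, a, rfl⟩
    have hu : IsUnit (t * a + 1) := by
      by_contra hu
      have h1 := (IsLocalRing.mem_maximalIdeal _).2 hu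
      have h2 : t * a ∈ IsLocalRing.maximalIdeal R :=
        Ideal.mul_mem_right _ _ ((IsLocalRing.mem_maximalIdeal _).2 ht)
      exact (IsLocalRing.maximalIdeal R).ne_top_iff_one.1 (IsLocalRing.maximalIdeal.isMaximal R).ne_top
        ((Ideal.add_mem_iff_right _ h2).1 h1)
    convert hu.map (frobenius R p).rangeRestrict
    refine Subtype.ext ?_
    simp [frobenius_def]
  · intro f _
    obtain ⟨a, ha, r, hr⟩ := exists_sum_eq_add ρ hρ' hρ hy S hS p le_rfl f
    rw [hr]
    refine add_mem (Submodule.mem_sup_left ha) (Submodule.mem_sup_right ?_)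
    have : t ^ p * r = (⟨t ^ p, hS t⟩ : S) • r := rfl
    rw [this]
    exact Submodule.smul_mem_smul (Ideal.mem_span_singleton_self _) trivial

-- A linear relation remains one after dividing the `p`-th roots of its coefficients by any `t ^ n`.
-- These quotients all lie in `R`, so the coefficients are infinitely divisible by `t` and vanish.
-- Spanning descends from `R`, as denominators can be made `p`-th powers.
include ρ in
theorem isPBasis_consFamily [CharP K p] [IsDiscreteValuationRing R] [CharP R p] (ht : Irreducible t)
    (hρ' : Function.Surjective ρ) (hρ : ∀ r, ρ r = 0 ↔ t ∣ r)
    (hy : IsPBasis p fun i => ρ (y i)) [Module.Finite (frobenius R p).range R] :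
    IsPBasis p fun i => algebraMap R K (consFamily t y i) := by
  constructor
  · rw [Fintype.linearIndependent_iff]
    intro c hc γ
    choose d hd using fun γ => (c γ).2
    have hd' (γ) : d γ ^ p = c γ := hd γ
    have hmem (n : ℕ) : d γ / algebraMap R K t ^ n ∈ (algebraMap R K).range := by
      refine mem_range_of_sum_mem_range ρ ht hρ hy (fun γ => d γ / algebraMap R K t ^ n) ?_ γ
      have : ∑ γ, (d γ / algebraMap R K t ^ n) ^ p *
          pMonomial (fun i => algebraMap R K (consFamily t y i)) γ =
          (algebraMap R K t ^ n)⁻¹ ^ p * ∑ γ, c γ •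
          pMonomial (fun i => algebraMap R K (consFamily t y i)) γ := by
        rw [Finset.mul_sum]
        refine Finset.sum_congr rfl fun γ _ => ?_
        rw [Subfield.smul_def, smul_eq_mul, ← hd', div_eq_mul_inv]
        ring
      rw [this, hc, mul_zero]
      exact zero_mem _
    have ht0 : algebraMap R K t ≠ 0 :=
      (map_ne_zero_iff _ (IsFractionRing.injective R K)).2 ht.ne_zero
    have hd0 : d γ = 0 := by
      obtain ⟨a, ha⟩ := hmem 0
      rw [pow_zero, div_one] at ha
      have hdvd (n : ℕ) : t ^ n ∣ a := by
        obtain ⟨b, hb⟩ := hmem n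
        refine ⟨b, IsFractionRing.injective R K ?_⟩
        rw [map_mul, map_pow, hb, ha]
        field_simp
      by_contra hne
      have ha0 : a ≠ 0 := fun h => hne (by rw [← ha, h, map_zero])
      obtain ⟨n, v, hv⟩ := IsDiscreteValuationRing.eq_unit_mul_pow_irreducible ha0 ht
      have h1 := hdvd (n + 1)
      rw [hv, pow_succ', mul_dvd_mul_iff_right (pow_ne_zero _ ht.ne_zero)] at h1
      exact ht.not_isUnit (isUnit_of_dvd_unit h1 v.isUnit)
    refine Subtype.ext ?_
    rw [← hd', hd0, zero_pow hp.out.ne_zero]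
    rfl
  · rintro z -
    obtain ⟨a, s, hs, rfl⟩ := IsFractionRing.div_surjective (A := R) z
    have hs0 : algebraMap R K s ≠ 0 :=
      IsLocalization.to_map_ne_zero_of_mem_nonZeroDivisors _ le_rfl hs
    have h1 : algebraMap R K a / algebraMap R K s =
        (⟨(algebraMap R K s)⁻¹ ^ p, pow_mem_pthPowers p _⟩ : pthPowers p K) •
          algebraMap R K (a * s ^ (p - 1)) := by
      have e1 : (algebraMap R K s)⁻¹ ^ p = (algebraMap R K s)⁻¹ * (algebraMap R K s)⁻¹ ^ (p - 1) :=
        (mul_pow_sub_one hp.out.ne_zero _).symm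
      rw [Subfield.smul_def, smul_eq_mul, map_mul, map_pow]
      simp only [e1]
      rw [inv_pow]
      field_simp
    rw [h1]
    refine Submodule.smul_mem _ _ ?_
    have h2 : a * s ^ (p - 1) ∈ Submodule.span (frobenius R p).range
        (Set.range (pMonomial (p := p) (consFamily t y))) := by
      rw [span_consFamily_eq_top ρ ht.not_isUnit hρ' hρ hy]
      trivial
    refine Submodule.span_induction (p := fun r _ => algebraMap R K r ∈ _) ?_ ?_ ?_ ?_ h2
    · rintro _ ⟨γ, rfl⟩
      exact Submodule.subset_span ⟨γ, (map_pMonomial _ _ _).symm⟩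
    · rw [map_zero]; exact zero_mem _
    · intro a b _ _ ha hb
      rw [map_add]; exact add_mem ha hb
    · rintro ⟨_, r, rfl⟩ b _ hb
      have : algebraMap R K ((⟨frobenius R p r, r, rfl⟩ : (frobenius R p).range) • b) =
          (⟨algebraMap R K r ^ p, pow_mem_pthPowers p _⟩ : pthPowers p K) • algebraMap R K b := by
        change algebraMap R K (r ^ p * b) = algebraMap R K r ^ p * algebraMap R K b
        rw [map_mul, map_pow]
      rw [this]
      exact Submodule.smul_mem _ _ hb

end DVR

/-! ### Noetherian normal domains and discrete valuation rings -/

section Normal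

/-- A noetherian integrally closed local domain is a discrete valuation ring if some fraction
outside it multiplies its maximal ideal into it. -/
theorem isDiscreteValuationRing_of_mul_mem {R K : Type*} [CommRing R] [IsDomain R] [IsLocalRing R]
    [IsNoetherianRing R] [IsIntegrallyClosed R] [Field K] [Algebra R K] [IsFractionRing R K]
    (y : K) (hy : y ∉ (algebraMap R K).range) (hR : ¬ IsField R)
    (hm : ∀ r ∈ IsLocalRing.maximalIdeal R, algebraMap R K r * y ∈ (algebraMap R K).range) :
    IsDiscreteValuationRing R := by
  have hinj := IsFractionRing.injective R K
  have hbot : IsLocalRing.maximalIdeal R ≠ ⊥ := fun h =>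
    hR (IsLocalRing.isField_iff_maximalIdeal_eq.2 h)
  -- If `y` mapped the maximal ideal into itself, it would be integral over `R`, hence in `R`. So
  -- some `r * y` is a unit, and `r` generates the maximal ideal.
  obtain ⟨r, hr, u, hu, hru⟩ : ∃ r ∈ IsLocalRing.maximalIdeal R, ∃ u, IsUnit u ∧
      algebraMap R K u = algebraMap R K r * y := by
    by_contra! hcon
    refine hy (IsIntegrallyClosed.isIntegral_iff.1 ?_)
    let N : Submodule R K := Submodule.map (Algebra.linearMap R K) (IsLocalRing.maximalIdeal R)
    refine isIntegral_of_smul_mem_submodule N ?_ ?_ y ?_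
    · intro h
      refine hbot ((Submodule.eq_bot_iff _).2 fun r hr => hinj ?_)
      rw [map_zero]
      exact (Submodule.eq_bot_iff _).1 h _ ⟨r, hr, rfl⟩
    · exact (IsNoetherian.noetherian (IsLocalRing.maximalIdeal R)).map _
    · rintro _ ⟨r, hr, rfl⟩
      obtain ⟨v, hv⟩ := hm r hr
      refine ⟨v, ?_, ?_⟩
      · by_contra hnu
        exact hcon r hr v (by simpa using hnu) hv
      · rw [smul_eq_mul, mul_comm]; exact hv
  have hprin : (IsLocalRing.maximalIdeal R).IsPrincipal := by
    refine ⟨⟨r, le_antisymm (fun s hs => ?_) ?_⟩⟩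
    · obtain ⟨v, hv⟩ := hm s hs
      obtain ⟨u', rfl⟩ := hu
      refine Ideal.mem_span_singleton'.2 ⟨v * (u'⁻¹ : Rˣ), hinj ?_⟩
      have h1 : algebraMap R K u' * algebraMap R K (u'⁻¹ : Rˣ) = 1 := by
        rw [← map_mul, Units.mul_inv, map_one]
      rw [map_mul, map_mul, hv]
      calc algebraMap R K s * y * algebraMap R K (u'⁻¹ : Rˣ) * algebraMap R K r
          = algebraMap R K s * (algebraMap R K r * y * algebraMap R K (u'⁻¹ : Rˣ)) := by ring
        _ = algebraMap R K s := by rw [← hru, h1, mul_one]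
    · exact (Ideal.span_singleton_le_iff_mem _).2 hr
  exact ((IsDiscreteValuationRing.TFAE R hR).out 0 4).2 hprin

theorem isFractionRing_localizationAtPrime {A : Type*} [CommRing A] [IsDomain A] (P : Ideal A)
    [P.IsPrime] : IsFractionRing (Localization.AtPrime P) (FractionRing A) :=
  IsFractionRing.isFractionRing_of_isDomain_of_isLocalization P.primeCompl _ _

/-- An element of the fraction field of a noetherian normal domain that is not integral has a
pole at a prime whose local ring is a discrete valuation ring. -/
theorem exists_isDiscreteValuationRing_of_notMem {A : Type*} [CommRing A] [IsDomain A]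
    [IsNoetherianRing A] [IsIntegrallyClosed A] (x : FractionRing A)
    (hx : x ∉ (algebraMap A (FractionRing A)).range) :
    ∃ (P : Ideal A) (_ : P.IsPrime), IsDiscreteValuationRing (Localization.AtPrime P) ∧
      x ∉ (algebraMap (Localization.AtPrime P) (FractionRing A)).range := by
  -- The denominators of `x` form the annihilator of its class modulo `A`. This lies in an
  -- associated prime `P`, the exact ideal of denominators of some `y`, and this `y` serves for the
  -- criterion at `P`.
  let M := (FractionRing A) ⧸ LinearMap.range (Algebra.linearMap A (FractionRing A))
  have hmk (a : A) (z : (FractionRing A)) : a ∈ (⊥ : Submodule A M).colon {Submodule.Quotient.mk z} ↔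
      algebraMap A (FractionRing A) a * z ∈ (algebraMap A (FractionRing A)).range := by
    rw [Submodule.mem_colon_singleton, Submodule.mem_bot,
      ← Submodule.Quotient.mk_smul, Submodule.Quotient.mk_eq_zero, Algebra.smul_def]
    rfl
  have hx0 : (Submodule.Quotient.mk x : M) ≠ 0 := fun h => hx ((Submodule.Quotient.mk_eq_zero _).1 h)
  obtain ⟨P, hP, hle⟩ := exists_le_isAssociatedPrime_of_isNoetherianRing A _ hx0
  obtain ⟨hprime, z, hz⟩ := isAssociatedPrime_iff.1 hP
  obtain ⟨y, rfl⟩ := Submodule.Quotient.mk_surjective _ z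
  have hy (a : A) : a ∈ P ↔ algebraMap A (FractionRing A) a * y ∈ (algebraMap A (FractionRing A)).range := by
    rw [hz]; exact hmk a y
  have hpole (w : (FractionRing A)) (hw : ∀ a, algebraMap A (FractionRing A) a * w ∈ (algebraMap A (FractionRing A)).range → a ∈ P) :
      w ∉ (algebraMap (Localization.AtPrime P) (FractionRing A)).range := by
    rintro ⟨r, rfl⟩
    obtain ⟨a, s, rfl⟩ := IsLocalization.exists_mk'_eq P.primeCompl r
    refine s.2 (hw s ⟨a, ?_⟩)
    rw [IsScalarTower.algebraMap_apply A (Localization.AtPrime P) (FractionRing A), 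
      IsScalarTower.algebraMap_apply A (Localization.AtPrime P) (FractionRing A), ← map_mul,
      IsLocalization.mk'_spec']
  have hfrac := isFractionRing_localizationAtPrime P
  refine ⟨P, hprime, ?_, hpole x fun a ha => hle ((hmk a x).2 ha)⟩
  have : IsIntegrallyClosed (Localization.AtPrime P) :=
    isIntegrallyClosed_of_isLocalization _ P.primeCompl P.primeCompl_le_nonZeroDivisors
  have : IsNoetherianRing (Localization.AtPrime P) :=
    IsLocalization.isNoetherianRing P.primeCompl _ inferInstance
  refine isDiscreteValuationRing_of_mul_mem y (hpole y fun a => (hy a).2) (fun hF => ?_)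
    fun r hr => ?_
  · obtain ⟨a, b, hb, hab⟩ := IsFractionRing.div_surjective (A := A) y
    have hb0 : algebraMap A (FractionRing A) b ≠ 0 :=
      IsLocalization.to_map_ne_zero_of_mem_nonZeroDivisors _ le_rfl hb
    have hbP : b ∈ P := (hy b).2 ⟨a, by rw [← hab, mul_div_cancel₀ _ hb0]⟩
    have h1 : algebraMap A (Localization.AtPrime P) b ∈
        IsLocalRing.maximalIdeal (Localization.AtPrime P) :=
      (IsLocalization.AtPrime.to_map_mem_maximal_iff _ P b).2 hbP
    rw [(IsLocalRing.isField_iff_maximalIdeal_eq).1 hF, Ideal.mem_bot] at h1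
    refine hb0 ?_
    rw [IsScalarTower.algebraMap_apply A (Localization.AtPrime P) (FractionRing A), h1, map_zero]
  · obtain ⟨a, s, rfl⟩ := IsLocalization.exists_mk'_eq P.primeCompl r
    rw [IsLocalization.AtPrime.mk'_mem_maximal_iff _ P] at hr
    obtain ⟨b, hb⟩ := (hy a).1 hr
    refine ⟨IsLocalization.mk' _ b s, ?_⟩
    rw [IsLocalization.mk'_eq_mul_mk'_one b, IsLocalization.mk'_eq_mul_mk'_one a, map_mul, map_mul,
      ← IsScalarTower.algebraMap_apply, ← IsScalarTower.algebraMap_apply, hb]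
    ring

end Normal

theorem charP_of_natCast_eq_zero {p : ℕ} [hp : Fact p.Prime] {A : Type*} [CommRing A] [Nontrivial A]
    (h : (p : A) = 0) : CharP A p :=
  ringChar.of_eq (CharP.ringChar_of_prime_eq_zero hp.out h)

/-! ### Canonical splittings of normal rings and their functoriality -/

namespace FrobeniusThickening

section CanonicalSplitting

variable {p : ℕ} [hp : Fact p.Prime] {A T : Type*} [CommRing A] [CommRing T]
  {P : FrobeniusThickening p A T}

/-- By uniqueness `τ` may be computed in any `p`-basis lifted to `T`. One adapted to `R` makes `τ a
^ p` lie in `R` by `splitting_mem`, and `R` is integrally closed. -/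
theorem IsCanonical.mem_range_of_isDiscreteValuationRing [IsDomain A] {K : Type*} [Field K]
    [CharP K p] [Algebra A K] [IsFractionRing A K] {τ : K →+ K} (hτ : P.IsCanonical K τ)
    {G : Set A} (hG : G.Finite) (hgen : FrobeniusGenerated p G) {R : Type*} [CommRing R]
    [IsDomain R] [IsDiscreteValuationRing R] [Algebra A R] (Q : Ideal A) [Q.IsPrime]
    [IsLocalization.AtPrime R Q] [Algebra R K] [IsScalarTower A R K] [IsFractionRing R K] (a : A) :
    τ (algebraMap A K a) ∈ (algebraMap R K).range := by
  classical
  have : CharP R p := (algebraMap R K).charP (IsFractionRing.injective R K) p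
  let κ := IsLocalRing.ResidueField R
  let ρ : R →+* κ := IsLocalRing.residue R
  have hρs : Function.Surjective ρ := IsLocalRing.residue_surjective
  have : CharP κ p := charP_of_natCast_eq_zero (by
    rw [← map_natCast ρ, CharP.cast_eq_zero, map_zero])
  have hgenR : FrobeniusGenerated p (algebraMap A R '' G) :=
    hgen.of_isLocalization Q.primeCompl
  have hgenκ : FrobeniusGenerated p (ρ.comp (algebraMap A R) '' G) := by
    rw [RingHom.coe_comp, Set.image_comp]
    exact hgenR.map ρ fun b => by
      obtain ⟨r, rfl⟩ := hρs b
      exact ⟨r, 1, by simp⟩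
  obtain ⟨n, _, y, hy⟩ := FrobeniusGenerated.exists_isPBasis hG (ρ.comp (algebraMap A R)) hgenκ
  obtain ⟨ϖ, hϖ⟩ := IsDiscreteValuationRing.exists_irreducible R
  -- The uniformizer is replaced by its numerator in `A`, which lifts to `T`.
  obtain ⟨t, s, hts⟩ := IsLocalization.exists_mk'_eq Q.primeCompl ϖ
  have ht : Irreducible (algebraMap A R t) := by
    refine (Associated.irreducible_iff ?_).1 hϖ
    refine ⟨(IsLocalization.map_units R s).unit, ?_⟩
    rw [← hts, IsUnit.unit_spec, IsLocalization.mk'_spec]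
  have hρ (r : R) : ρ r = 0 ↔ algebraMap A R t ∣ r := by
    rw [IsLocalRing.residue_eq_zero_iff, ht.maximalIdeal_eq, Ideal.mem_span_singleton]
  have : Module.Finite (frobenius R p).range R :=
    hgenR.finite (hG.image _) _ fun r => ⟨⟨_, r, rfl⟩, rfl⟩
  have hbas := isPBasis_consFamily (K := K) ρ ht hρs hρ hy
  choose ξ hξ using fun i => P.red_surjective (consFamily t y i)
  have hξ' : (fun i => algebraMap R K (consFamily (algebraMap A R t)
      (fun i => algebraMap A R (y i)) i)) = fun i => algebraMap A K (P.red (ξ i)) := by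
    funext i
    rw [hξ, IsScalarTower.algebraMap_apply A R K]
    rcases i with _ | i <;> rfl
  have hcoord (f : K) (hf : f ∈ (algebraMap R K).range) (α : Option n → ZMod p) :
      (hbas.basis.repr f α : K) ∈ (algebraMap R K).range := by
    choose c hc using fun γ => (hbas.basis.repr f γ).2
    have hc' (γ) : c γ ^ p = hbas.basis.repr f γ := hc γ
    have hsum := hbas.basis.sum_repr f
    rw [← hc']
    refine pow_mem (mem_range_of_sum_mem_range ρ ht hρ hy c ?_ α) p
    convert hf
    rw [← hsum]
    refine Finset.sum_congr rfl fun γ _ => ?_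
    rw [hc', IsPBasis.basis_apply, Subfield.smul_def, smul_eq_mul]
  have hx (i) : algebraMap R K (consFamily (algebraMap A R t)
      (fun i => algebraMap A R (y i)) i) ∈ (algebraMap R K).range := ⟨_, rfl⟩
  have hA (b : A) : algebraMap A K b ∈ (algebraMap R K).range :=
    ⟨algebraMap A R b, (IsScalarTower.algebraMap_apply A R K b).symm⟩
  have hmem := hbas.splitting_mem hx hcoord (fun i => algebraMap A K (P.delta (ξ i)))
    (fun i => hA _) (hA a)
  have hpot : (fun i => algebraMap A K (P.delta (ξ i)) / algebraMap R K (consFamily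
      (algebraMap A R t) (fun i => algebraMap A R (y i)) i) ^ p) = P.potential K ξ :=
    funext fun i => by rw [potential, ← congrFun hξ' i]
  rw [hpot] at hmem
  clear hpot hx hcoord
  revert hbas
  rw [hξ']
  intro hbas hmem
  have h1 := splittingOfPBasis_pow hbas (algebraMap A K a)
  rw [← hτ.eq_splittingOfPBasis hbas] at h1
  have h2 : τ (algebraMap A K a) ^ p ∈ (algebraMap R K).range := by rw [h1]; exact hmem
  obtain ⟨r, hr⟩ := h2
  exact IsIntegrallyClosed.exists_algebraMap_eq_of_isIntegral_pow hp.out.pos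
    (hr ▸ isIntegral_algebraMap)

theorem exists_isPBasis_red {G : Set A} (hG : G.Finite) (hgen : FrobeniusGenerated p G)
    (P : FrobeniusThickening p A T) (K : Type*) [Field K] [CharP K p] [Algebra A K]
    [IsFractionRing A K] : ∃ (n : Type) (_ : Fintype n) (_ : DecidableEq n) (ξ : n → T),
      IsPBasis p fun i => algebraMap A K (P.red (ξ i)) := by
  classical
  obtain ⟨n, hn, x, hx⟩ := FrobeniusGenerated.exists_isPBasis hG (algebraMap A K)
    (hgen.of_isLocalization (nonZeroDivisors A))
  choose ξ hξ using fun i => P.red_surjective (x i)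
  exact ⟨n, hn, inferInstance, ξ, by simpa only [hξ] using hx⟩

/-- An element of `B` is a fraction `a / s` over `A`; multiplied by `s ^ p` it becomes `s ^ (p - 1)
* a`, where horizontality is known. -/
theorem horizontal_of_map [IsDomain A] {B U : Type*} [CommRing B] [CommRing U]
    (Q : FrobeniusThickening p B U) (f : A →+* B) (g : T →+* U)
    (hg : ∀ x, Q.red (g x) = f (P.red x)) (hF : ∀ x, Q.frob (g x) = g (P.frob x))
    {K : Type*} [Field K] [CharP K p] [Algebra A K] [Algebra B K] [IsFractionRing A K]
    (hB : Function.Injective (algebraMap B K)) (hf : ∀ a, algebraMap B K (f a) = algebraMap A K a)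
    (D : Derivation ℤ K K) (hD : P.Horizontal D) : Q.Horizontal D := by
  have hform (x : T) : Q.form D (g x) = P.form D x := by
    rw [form, form, delta_map P Q f g hg hF, hg, hf, hf]
  intro y
  obtain ⟨a, s, hs, has⟩ := IsFractionRing.div_surjective (A := A) (algebraMap B K (Q.red y))
  have hs0 : algebraMap A K s ≠ 0 :=
    IsLocalization.to_map_ne_zero_of_mem_nonZeroDivisors _ le_rfl hs
  obtain ⟨a, rfl⟩ := P.red_surjective a
  obtain ⟨s, rfl⟩ := P.red_surjective s
  refine Q.mem_formSubsemiring_of_pow_mul D (s := g s) (by rwa [hg, hf]) ?_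
  rw [mem_formSubsemiring, Q.form_congr D (y := g (s ^ (p - 1) * a)), hform]
  · exact hD _
  · refine hB ?_
    rw [map_mul, map_pow, hg, hg, map_mul, map_pow, hf, hf, ← has, map_mul, map_pow, map_mul,
      map_pow, ← mul_pow_sub_one hp.out.ne_zero (algebraMap A K (P.red s))]
    field_simp

variable (P) in
/-- The restriction to the ring of a canonical splitting of the fraction field. -/
def IsCanonicalSplitting [IsDomain A] [CharP A p] (σ : A → A) : Prop :=
  ∃ τ : FractionRing A →+ FractionRing A, P.IsCanonical (FractionRing A) τ ∧
    ∀ a, algebraMap A (FractionRing A) (σ a) = τ (algebraMap A (FractionRing A) a)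

variable [IsDomain A] [CharP A p]

theorem exists_isCanonicalSplitting [IsNoetherianRing A] [IsIntegrallyClosed A] {G : Set A}
    (hG : G.Finite) (hgen : FrobeniusGenerated p G) (P : FrobeniusThickening p A T) :
    ∃ σ, P.IsCanonicalSplitting σ := by
  obtain ⟨n, _, _, ξ, h⟩ := exists_isPBasis_red hG hgen P (FractionRing A)
  have hτ := isCanonical_splittingOfPBasis h
  have hmem (a : A) : splittingOfPBasis h (algebraMap A _ a) ∈
      (algebraMap A (FractionRing A)).range := by
    by_contra hcon
    obtain ⟨Q, hQ, hdvr, hnot⟩ := exists_isDiscreteValuationRing_of_notMem _ hcon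
    have := isFractionRing_localizationAtPrime Q
    exact hnot (hτ.mem_range_of_isDiscreteValuationRing hG hgen Q a)
  choose σ hσ using hmem
  exact ⟨σ, _, hτ, hσ⟩

theorem IsCanonicalSplitting.isFrobeniusSplitting {σ : A → A} (hσ : P.IsCanonicalSplitting σ) :
    IsFrobeniusSplitting p σ := by
  obtain ⟨τ, hτ, h⟩ := hσ
  have hinj := IsFractionRing.injective A (FractionRing A)
  exact ⟨fun a b => hinj (by simp [h]), fun a b => hinj (by simp [h, hτ.map_pow_mul]),
    hinj (by simp [h, hτ.map_one])⟩

variable {B U : Type*} [CommRing B] [CommRing U]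

/-- Both splittings give canonical splittings for `P` on the fraction field of `B`: one by
transport, the other because derivations horizontal for `P` are horizontal for `Q`. Uniqueness
identifies them. -/
theorem IsCanonicalSplitting.map_eq [IsDomain B] [CharP B p] {Q : FrobeniusThickening p B U}
    {G : Set A} (hG : G.Finite) (hgen : FrobeniusGenerated p G) {σ : A → A}
    (hσ : P.IsCanonicalSplitting σ) {σ' : B → B} (hσ' : Q.IsCanonicalSplitting σ')
    (f : A →+* B) (g : T →+* U)
    (hg : ∀ x, Q.red (g x) = f (P.red x)) (hF : ∀ x, Q.frob (g x) = g (P.frob x))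
    (hfrac : @IsFractionRing A _ (FractionRing B) _
      ((algebraMap B (FractionRing B)).comp f).toAlgebra) (a : A) : σ' (f a) = f (σ a) := by
  obtain ⟨τ, hτ, h⟩ := hσ
  obtain ⟨τ', hτ', h'⟩ := hσ'
  let : Algebra A (FractionRing B) := ((algebraMap B (FractionRing B)).comp f).toAlgebra
  have hinj := IsFractionRing.injective B (FractionRing B)
  let e : FractionRing A ≃ₐ[A] FractionRing B := FractionRing.algEquiv A (FractionRing B)
  have hτ₁ := hτ.congr e
  have hτ₂ : P.IsCanonical (FractionRing B) τ' := ⟨hτ'.map_one, hτ'.map_pow_mul, fun D hD =>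
    hτ'.map_derivation D (horizontal_of_map Q f g hg hF hinj (fun _ => rfl) D hD)⟩
  obtain ⟨n, _, _, ξ, hx⟩ := exists_isPBasis_red hG hgen P (FractionRing B)
  have heq := (hτ₁.eq_splittingOfPBasis hx).trans (hτ₂.eq_splittingOfPBasis hx).symm
  refine hinj ?_
  have h1 := DFunLike.congr_fun heq (algebraMap A (FractionRing B) a)
  change e (τ (e.symm _)) = _ at h1
  rw [AlgEquiv.commutes, ← h, AlgEquiv.commutes] at h1
  exact (h' _).trans h1.symm

end CanonicalSplitting

end FrobeniusThickening

/-! ### Length-two Witt vectors of a perfect ring -/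

namespace W2

section

variable {p : ℕ} [hp : Fact p.Prime] {k : Type*} [CommRing k] [CharP k p]

theorem coeff_zero_natCast_mul (x : TruncatedWittVector p 2 k) :
    ((p : TruncatedWittVector p 2 k) * x).coeff 0 = 0 := by
  obtain ⟨x, rfl⟩ := WittVector.truncate_surjective p 2 k x
  rw [← map_natCast (WittVector.truncate 2), ← map_mul, WittVector.coeff_truncate, mul_comm]
  exact WittVector.mul_charP_coeff_zero x

theorem coeff_one_natCast_mul (x : TruncatedWittVector p 2 k) :
    ((p : TruncatedWittVector p 2 k) * x).coeff 1 = x.coeff 0 ^ p := by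
  obtain ⟨x, rfl⟩ := WittVector.truncate_surjective p 2 k x
  rw [← map_natCast (WittVector.truncate 2), ← map_mul, WittVector.coeff_truncate, mul_comm,
    WittVector.coeff_truncate]
  exact WittVector.mul_charP_coeff_succ x 0

variable [PerfectRing k p]

theorem coeff_zero_eq_zero_iff (x : TruncatedWittVector p 2 k) :
    x.coeff 0 = 0 ↔ ∃ y, x = p * y := by
  refine ⟨fun h => ?_, fun ⟨y, hy⟩ => by rw [hy, coeff_zero_natCast_mul]⟩
  obtain ⟨b, hb⟩ := (PerfectRing.bijective_frobenius (R := k) (p := p)).2 (x.coeff 1)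
  refine ⟨TruncatedWittVector.mk p fun _ => b, TruncatedWittVector.ext fun i => ?_⟩
  match i with
  | 0 => rw [h, coeff_zero_natCast_mul]
  | 1 => rw [coeff_one_natCast_mul, TruncatedWittVector.coeff_mk, ← hb]

theorem natCast_mul_eq_zero_iff (x : TruncatedWittVector p 2 k) :
    p * x = 0 ↔ x.coeff 0 = 0 := by
  constructor
  · intro h
    have h1 := coeff_one_natCast_mul x
    rw [h, TruncatedWittVector.coeff_zero] at h1
    refine (PerfectRing.bijective_frobenius (R := k) (p := p)).1 ?_
    exact h1.symm.trans (zero_pow hp.out.ne_zero).symm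
  · intro h
    refine TruncatedWittVector.ext fun i => ?_
    match i with
    | 0 => rw [coeff_zero_natCast_mul, TruncatedWittVector.coeff_zero]
    | 1 => rw [coeff_one_natCast_mul, h, TruncatedWittVector.coeff_zero, zero_pow hp.out.ne_zero]

theorem natCast_pow_two : (p : TruncatedWittVector p 2 k) ^ 2 = 0 := by
  rw [pow_two, natCast_mul_eq_zero_iff]
  simpa using coeff_zero_natCast_mul (1 : TruncatedWittVector p 2 k)

theorem exists_eq_pow_add (x : TruncatedWittVector p 2 k) : ∃ y z, x = y ^ p + p * z := by
  obtain ⟨b, hb⟩ := (PerfectRing.bijective_frobenius (R := k) (p := p)).2 (x.coeff 0)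
  let y : TruncatedWittVector p 2 k := TruncatedWittVector.mk p fun _ => b
  obtain ⟨z, hz⟩ := (coeff_zero_eq_zero_iff (x - y ^ p)).1 (by
    have h := map_sub (residue p k) x (y ^ p)
    rw [map_pow] at h
    refine h.trans ?_
    change x.coeff 0 - (y.coeff 0) ^ p = 0
    rw [TruncatedWittVector.coeff_mk, ← hb, sub_self])
  exact ⟨y, z, by rw [← hz]; ring⟩

/-- Homomorphisms out of the Witt vectors of length two over a perfect ring are determined by
their reductions. -/
theorem ringHom_ext {B : Type*} [CommRing B] {φ ψ : TruncatedWittVector p 2 k →+* B}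
    (h : ∀ x, (p : B) ∣ φ x - ψ x) : φ = ψ := by
  have h2 : (p : B) ^ 2 = 0 := by
    rw [← map_natCast φ, ← map_pow, natCast_pow_two, map_zero]
  ext x
  -- As `p ^ 2 = 0`, the images of `y ^ p` and `p * z` depend only on those of `y` and `z` modulo
  -- `p`.
  obtain ⟨y, z, rfl⟩ := exists_eq_pow_add x
  rw [← sub_eq_zero]
  have h3 := dvd_sub_pow_of_dvd_sub (h y) 1
  obtain ⟨w, hw⟩ := h z
  rw [pow_one, one_add_one_eq_two, h2, zero_dvd_iff] at h3
  simp only [map_add, map_mul, map_pow, map_natCast]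
  linear_combination h3 + (p : B) * hw + h2 * w

/-- By the equational criterion the relation `p • m = 0` comes from coefficients annihilated by `p`,
and over a perfect ring these are multiples of `p`. -/
theorem exists_eq_smul_of_flat {M : Type*} [AddCommGroup M] [Module (TruncatedWittVector p 2 k) M]
    [Module.Flat (TruncatedWittVector p 2 k) M] {m : M}
    (h : (p : TruncatedWittVector p 2 k) • m = 0) :
    ∃ y : M, m = (p : TruncatedWittVector p 2 k) • y := by
  obtain ⟨n, a, y, hy, ha⟩ := Module.Flat.isTrivialRelation_of_sum_smul_eq_zero
    (f := fun _ : Unit => (p : TruncatedWittVector p 2 k)) (x := fun _ => m) (by simpa using h)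
  choose b hb using fun j => (coeff_zero_eq_zero_iff (a () j)).1
    ((natCast_mul_eq_zero_iff _).1 (by simpa using ha j))
  refine ⟨∑ j, b j • y j, ?_⟩
  rw [Finset.smul_sum]
  refine (hy ()).trans ?_
  exact Finset.sum_congr rfl fun j _ => by rw [hb, mul_smul]

end

end W2

/-! ### Commutative algebra for affine charts -/

theorem FrobeniusGenerated.of_essFiniteType {p : ℕ} [Fact p.Prime] {R A : Type*} [CommRing R]
    [CommRing A] [Algebra R A] (hR : ∀ r : R, ∃ s, s ^ p = r) [Algebra.EssFiniteType R A] :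
    ∃ G : Set A, G.Finite ∧ FrobeniusGenerated p G := by
  let B := Algebra.EssFiniteType.subalgebra R A
  let s : Set B := Subtype.val ⁻¹' (Algebra.EssFiniteType.finset R A : Set A)
  have hs : s.Finite := Set.Finite.preimage Subtype.val_injective.injOn (Finset.finite_toSet _)
  have hgen : FrobeniusGenerated p s := by
    refine eq_top_iff.2 ?_
    rintro ⟨b, hb⟩ -
    refine Algebra.adjoin_induction (p := fun b hb =>
      (⟨b, hb⟩ : B) ∈ Subring.closure (Set.range (fun a : B => a ^ p) ∪ s)) ?_ ?_ ?_ ?_ hb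
    · intro x hx
      exact Subring.subset_closure (Or.inr hx)
    · intro r
      obtain ⟨r, rfl⟩ := hR r
      exact Subring.subset_closure (Or.inl ⟨algebraMap R B r, Subtype.ext (by simp)⟩)
    · intro x y hx hy h1 h2
      exact add_mem h1 h2
    · intro x y hx hy h1 h2
      exact mul_mem h1 h2
  exact ⟨_, hs.image _, hgen.of_isLocalization (Algebra.EssFiniteType.submonoid R A)⟩

/-- A noetherian ring whose local ring at a prime is a domain becomes a domain after inverting one
element outside the prime. -/
theorem exists_isDomain_away {A : Type u} [CommRing A] [IsNoetherianRing A] (Q : Ideal A)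
    [Q.IsPrime] (S : Type u) [CommRing S] [Algebra A S] [IsLocalization.AtPrime S Q] [IsDomain S] :
    ∃ g ∉ Q, ∀ (B : Type u) [CommRing B] [Algebra A B] [IsLocalization.Away g B], IsDomain B := by
  obtain ⟨t, ht⟩ := IsNoetherian.noetherian (RingHom.ker (algebraMap A S))
  have h1 (x : A) (hx : x ∈ RingHom.ker (algebraMap A S)) : ∃ s ∉ Q, s * x = 0 := by
    obtain ⟨s, hs⟩ := (IsLocalization.map_eq_zero_iff Q.primeCompl S x).1 hx
    exact ⟨s, s.2, hs⟩
  choose! s hs hs' using h1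
  have hmem (x : A) (hx : x ∈ t) : x ∈ RingHom.ker (algebraMap A S) :=
    ht ▸ Submodule.subset_span hx
  refine ⟨∏ x ∈ t, s x, fun h => ?_, fun B _ _ _ => ?_⟩
  · obtain ⟨x, hx, hxQ⟩ := (Ideal.IsPrime.prod_mem_iff (p := Q)).1 h
    exact hs x (hmem x hx) hxQ
  · set g := ∏ x ∈ t, s x
    have hg (x : A) (hx : x ∈ RingHom.ker (algebraMap A S)) : g * x = 0 := by
      rw [← ht] at hx
      refine Submodule.span_induction (p := fun x _ => g * x = 0) ?_ (mul_zero g) ?_ ?_ hx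
      · intro x hx
        obtain ⟨c, hc⟩ := Finset.dvd_prod_of_mem s hx
        have : g = s x * c := hc
        rw [this, mul_right_comm, hs' x (hmem x hx), zero_mul]
      · intro x y _ _ h h'
        rw [mul_add, h, h', add_zero]
      · intro a x _ h
        rw [smul_eq_mul, mul_left_comm, h, mul_zero]
    have hgS : IsUnit (algebraMap A S g) := by
      refine IsLocalization.map_units S (⟨g, fun h => ?_⟩ : Q.primeCompl)
      obtain ⟨x, hx, hxQ⟩ := (Ideal.IsPrime.prod_mem_iff (p := Q)).1 h
      exact hs x (hmem x hx) hxQ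
    refine Function.Injective.isDomain (IsLocalization.Away.lift g hgS : B →+* S) ?_
    rw [injective_iff_map_eq_zero]
    intro b hb
    obtain ⟨a, n, rfl⟩ := IsLocalization.exists_mk'_eq (Submonoid.powers g) b
    have h2 : algebraMap A S a = 0 := by
      have h3 := congrArg (IsLocalization.Away.lift g hgS) (IsLocalization.mk'_spec B a n)
      rwa [map_mul, hb, zero_mul, IsLocalization.Away.lift_eq, eq_comm] at h3
    refine (IsLocalization.mk'_eq_zero_iff _ _).2 ⟨⟨g, 1, pow_one g⟩, hg a h2⟩

theorem isFractionRing_comp {A B : Type*} [CommRing A] [CommRing B] [IsDomain B] (f : A →+* B)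
    (L : Type*) [Field L] [Algebra A L] [Algebra B L] [IsFractionRing A L] [IsFractionRing B L]
    (h : ∀ a, algebraMap B L (f a) = algebraMap A L a) :
    @IsFractionRing A _ (FractionRing B) _
      ((algebraMap B (FractionRing B)).comp f).toAlgebra := by
  let : Algebra A (FractionRing B) := ((algebraMap B (FractionRing B)).comp f).toAlgebra
  let e := (FractionRing.algEquiv B L).symm
  exact IsLocalization.isLocalization_of_algEquiv (nonZeroDivisors A)
    (AlgEquiv.ofRingEquiv (f := e.toRingEquiv) fun a => (congrArg e (h a)).symm.trans
      (e.commutes (f a)) : L ≃ₐ[A] FractionRing B)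

theorem W2.residue_surjective (p : ℕ) [hp : Fact p.Prime] (k : Type u) [CommRing k] :
    Function.Surjective (W2.residue p k) :=
  fun a => ⟨TruncatedWittVector.mk p fun _ => a,
    TruncatedWittVector.coeff_mk (p := p) (fun _ : Fin 2 => a) 0⟩

theorem exists_comp_eq_of_surjective {A B C : Type*} [CommRing A] [CommRing B] [CommRing C]
    (f : A →+* B) (hf : Function.Surjective f) (g : A →+* C) (h : ∀ a, f a = 0 → g a = 0) :
    ∃ ψ : B →+* C, ψ.comp f = g :=
  ⟨f.liftOfSurjective hf ⟨g, h⟩, f.liftOfRightInverse_comp _ _ ⟨g, h⟩⟩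

theorem appLE_comp_appLE_of_eq {X Y Z : Scheme.{u}} {a : X ⟶ Y} {b : Y ⟶ Z} {c : X ⟶ Z}
    (h : a ≫ b = c) {U : Z.Opens} {V : Y.Opens} {W : X.Opens} (h₁ : V ≤ b ⁻¹ᵁ U)
    (h₂ : W ≤ a ⁻¹ᵁ V) (h₃ : W ≤ c ⁻¹ᵁ U) : b.appLE U V h₁ ≫ a.appLE V W h₂ = c.appLE U W h₃ := by
  subst h
  exact Scheme.Hom.appLE_comp_appLE a b U V W h₁ h₂

theorem W2.surjective_specMap_residue (p : ℕ) [hp : Fact p.Prime] (k : Type u) [CommRing k]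
    [CharP k p] [PerfectRing k p] :
    Surjective (Spec.map (CommRingCat.ofHom (W2.residue p k))) := by
  have h (x : PrimeSpectrum (TruncatedWittVector p 2 k)) :
      x ∈ Set.range (PrimeSpectrum.comap (W2.residue p k)) := by
    rw [range_comap_of_surjective _ _ (W2.residue_surjective p k),
      PrimeSpectrum.mem_zeroLocus]
    intro a ha
    obtain ⟨b, rfl⟩ := (W2.coeff_zero_eq_zero_iff a).1 ha
    refine Ideal.IsPrime.mem_of_pow_mem (inferInstance : x.asIdeal.IsPrime) 2 ?_
    rw [mul_pow, W2.natCast_pow_two, zero_mul]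
    exact zero_mem _
  exact ⟨h⟩

/-! ### Sections of a lifting over affine opens -/

namespace W2Lifting

variable {p : ℕ} [hp : Fact p.Prime] {k : Type u} [Field k] {X : Scheme.{u}}
  {f : X ⟶ Spec (CommRingCat.of k)} (L : W2Lifting p f)

instance : IsClosedImmersion L.incl :=
  MorphismProperty.of_isPullback L.isPullback.flip
    (IsClosedImmersion.spec_of_surjective _ (W2.residue_surjective p k))

theorem surjective_incl [CharP k p] [PerfectRing k p] : Function.Surjective L.incl :=
  (MorphismProperty.of_isPullback (P := @Surjective) L.isPullback.flip
    (W2.surjective_specMap_residue p k)).surj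

theorem incl_preimage_le_iff [CharP k p] [PerfectRing k p] {V V' : L.scheme.Opens} :
    L.incl ⁻¹ᵁ V ≤ L.incl ⁻¹ᵁ V' ↔ V ≤ V' := by
  refine ⟨fun h x hx => ?_, fun h x hx => h hx⟩
  obtain ⟨y, rfl⟩ := L.surjective_incl x
  exact h hx

/-- The structure map on sections over an open subset. -/
def strMap (V : L.scheme.Opens) : W2 p k ⟶ Γ(L.scheme, V) :=
  (Scheme.ΓSpecIso _).inv ≫ L.str.appLE ⊤ V le_top

theorem fromSpec_str {V : L.scheme.Opens} (hV : IsAffineOpen V) :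
    hV.fromSpec ≫ L.str = Spec.map (L.strMap V) := by
  rw [← IsAffineOpen.SpecMap_appLE_fromSpec L.str (isAffineOpen_top _) hV le_top,
    IsAffineOpen.fromSpec_top, Scheme.isoSpec_Spec_inv, ← Spec.map_comp]
  rfl

theorem flat_strMap {V : L.scheme.Opens} (hV : IsAffineOpen V) : (L.strMap V).hom.Flat := by
  have h1 : (L.str.appLE ⊤ V le_top).hom.Flat :=
    HasRingHomProperty.appLE @Flat L.str L.flat ⟨⊤, isAffineOpen_top _⟩ ⟨V, hV⟩ le_top
  exact RingHom.Flat.comp (RingHom.Flat.of_bijective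
    (ConcreteCategory.bijective_of_isIso (Scheme.ΓSpecIso (W2 p k)).inv)) h1

theorem appLE_strMap {V : L.scheme.Opens} {U : X.Opens} (h : U ≤ L.incl ⁻¹ᵁ V) :
    L.strMap V ≫ L.incl.appLE V U h = (Scheme.ΓSpecIso _).inv ≫
      (f ≫ Spec.map (CommRingCat.ofHom (W2.residue p k))).appLE ⊤ U le_top := by
  rw [strMap, Category.assoc]
  exact congrArg _ (appLE_comp_appLE_of_eq L.isPullback.w _ _ _)

variable [CharP k p] [PerfectRing k p]

/-- The spectrum of `Γ(V) / p` lies over `Spec k`, so by the pullback property it maps to `X`,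
landing in `U`. A section of `V` vanishing on `U` therefore vanishes modulo `p`. -/
theorem exists_eq_natCast_mul {V : L.scheme.Opens} (hV : IsAffineOpen V) {U : X.Opens}
    (h : L.incl ⁻¹ᵁ V = U) {x : Γ(L.scheme, V)} (hx : (L.incl.appLE V U h.ge).hom x = 0) :
    ∃ y, x = p * y := by
  let q : Γ(L.scheme, V) ⟶ CommRingCat.of (Γ(L.scheme, V) ⧸ Ideal.span {(p : Γ(L.scheme, V))}) :=
    CommRingCat.ofHom (Ideal.Quotient.mk _)
  have hp0 : q.hom (p : Γ(L.scheme, V)) = 0 :=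
    Ideal.Quotient.eq_zero_iff_mem.2 (Ideal.mem_span_singleton_self _)
  obtain ⟨ψ, hψ'⟩ := exists_comp_eq_of_surjective (W2.residue p k) (W2.residue_surjective p k)
    (L.strMap V ≫ q).hom fun a ha => by
      obtain ⟨b, rfl⟩ := (W2.coeff_zero_eq_zero_iff a).1 ha
      rw [map_mul, map_natCast, ← map_natCast q.hom, hp0, zero_mul]
  have hψ : CommRingCat.ofHom (W2.residue p k) ≫ CommRingCat.ofHom ψ = L.strMap V ≫ q :=
    CommRingCat.hom_ext hψ'
  let l := L.isPullback.lift (Spec.map q ≫ hV.fromSpec) (Spec.map (CommRingCat.ofHom ψ)) (by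
    rw [Category.assoc, L.fromSpec_str hV, ← Spec.map_comp, ← Spec.map_comp, hψ])
  have hl : l ≫ L.incl = Spec.map q ≫ hV.fromSpec := L.isPullback.lift_fst _ _ _
  have hle' : ⊤ ≤ (Spec.map q ≫ hV.fromSpec) ⁻¹ᵁ V := by
    rw [Scheme.Hom.comp_preimage, IsAffineOpen.fromSpec_preimage_self]
    exact le_rfl
  have hle : ⊤ ≤ l ⁻¹ᵁ U := by
    rw [← h, ← Scheme.Hom.comp_preimage, hl]
    exact hle'
  have h1 : L.incl.appLE V U h.ge ≫ l.appLE U ⊤ hle = q ≫ (Scheme.ΓSpecIso _).inv := by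
    refine (appLE_comp_appLE_of_eq hl _ _ hle').trans ?_
    rw [Scheme.Hom.comp_appLE, IsAffineOpen.fromSpec_app_self, Category.assoc]
    refine (congrArg _ (Scheme.Hom.map_appLE _ _ _)).trans ?_
    rw [Scheme.ΓSpecIso_inv_naturality]
    exact congrArg _ (Scheme.Hom.appLE_eq_app _)
  have h2 := congrArg (fun g => g.hom x) h1
  simp only [CommRingCat.hom_comp, RingHom.comp_apply, hx, map_zero] at h2
  have h3 : q.hom x = 0 := by
    have := (ConcreteCategory.bijective_of_isIso (Scheme.ΓSpecIso (CommRingCat.of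
      (Γ(L.scheme, V) ⧸ Ideal.span {(p : Γ(L.scheme, V))}))).inv).1
    exact this (h2.symm.trans (map_zero _).symm)
  obtain ⟨y, hy⟩ := Ideal.mem_span_singleton.1 (Ideal.Quotient.eq_zero_iff_mem.1 h3)
  exact ⟨y, hy⟩

theorem exists_eq_natCast_mul_of_mul_eq_zero {V : L.scheme.Opens} (hV : IsAffineOpen V)
    {x : Γ(L.scheme, V)} (hx : p * x = 0) : ∃ y, x = p * y := by
  let : Algebra (TruncatedWittVector p 2 k) Γ(L.scheme, V) := (L.strMap V).hom.toAlgebra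
  have : Module.Flat (TruncatedWittVector p 2 k) Γ(L.scheme, V) := L.flat_strMap hV
  have hsmul (y : Γ(L.scheme, V)) : (p : TruncatedWittVector p 2 k) • y = p * y := by
    rw [Algebra.smul_def, map_natCast]
  obtain ⟨y, hy⟩ := W2.exists_eq_smul_of_flat (p := p) (k := k) (m := x) (by rw [hsmul, hx])
  exact ⟨y, by rw [hy, hsmul]⟩

end W2Lifting

theorem absFrobenius_appLE (p : ℕ) [Fact p.Prime] (X : Scheme.{u}) (h : HasCharP p X)
    (U : X.Opens) (e) (a : Γ(X, U)) : ((absFrobenius p X h).appLE U U e).hom a = a ^ p := by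
  have h1 : (absFrobenius p X h).appLE U U e = (absFrobenius p X h).app U :=
    Scheme.Hom.appLE_eq_app _
  rw [h1]
  rfl

/-! ### Thickenings coming from a Frobenius lifting -/

namespace FrobeniusLifting

variable {p : ℕ} [hp : Fact p.Prime] {k : Type u} [Field k] [CharP k p] [PerfectRing k p]
  {X : Scheme.{u}} {f : X ⟶ Spec (CommRingCat.of k)} (L : FrobeniusLifting p f)

theorem frob_apply (x : L.scheme) : L.frob x = x := by
  obtain ⟨y, rfl⟩ := L.surjective_incl x
  rw [← Scheme.Hom.comp_apply, L.incl_frob]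
  rfl

theorem frob_preimage (V : L.scheme.Opens) : L.frob ⁻¹ᵁ V = V :=
  Opens.ext (Set.ext fun x => by
    change L.frob x ∈ V ↔ x ∈ V
    rw [frob_apply])

/-- The thickening of the coordinate ring of an affine open subset given by a lifting of the
Frobenius. -/
def thickening {V : L.scheme.Opens} (hV : IsAffineOpen V) {U : X.Opens} (h : L.incl ⁻¹ᵁ V = U) :
    FrobeniusThickening p Γ(X, U) Γ(L.scheme, V) where
  red := (L.incl.appLE V U h.ge).hom
  frob := (L.frob.appLE V V (L.frob_preimage V).ge).hom
  red_surjective := by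
    subst h
    have h1 : L.incl.appLE V (L.incl ⁻¹ᵁ V) le_rfl = L.incl.app V := Scheme.Hom.appLE_eq_app _
    rw [h1]
    exact Scheme.Hom.app_surjective _ V hV
  red_eq_zero_iff x := ⟨L.exists_eq_natCast_mul hV h, fun ⟨y, hy⟩ => by
    rw [hy, map_mul, map_natCast, (hasCharP_of_hom f).sections U, zero_mul]⟩
  mul_eq_zero_iff x := by
    constructor
    · intro hx
      obtain ⟨y, rfl⟩ := L.exists_eq_natCast_mul_of_mul_eq_zero hV hx
      rw [map_mul, map_natCast, (hasCharP_of_hom f).sections U, zero_mul]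
    · intro hx
      obtain ⟨y, rfl⟩ := L.exists_eq_natCast_mul hV h hx
      have h2 : (p : Γ(L.scheme, V)) ^ 2 = 0 := by
        rw [← map_natCast (L.strMap V).hom, ← map_pow]
        exact (congrArg _ W2.natCast_pow_two).trans (map_zero _)
      rw [← mul_assoc, ← pow_two, h2, zero_mul]
  red_frob x := by
    have h1 : L.frob.appLE V V (L.frob_preimage V).ge ≫ L.incl.appLE V U h.ge =
        L.incl.appLE V U h.ge ≫ (absFrobenius p X (hasCharP_of_hom f)).appLE U U le_rfl :=
      (appLE_comp_appLE_of_eq L.incl_frob _ _ h.ge).trans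
        (appLE_comp_appLE_of_eq rfl _ _ _).symm
    have h2 := congrArg (fun g => g.hom x) h1
    exact h2.trans (absFrobenius_appLE p X _ U _ _)

end FrobeniusLifting

/-! ### Affine opens of the special fibre -/

section

variable {X : Scheme.{u}}

/-- An affine open subset whose ring of functions is noetherian and finitely generated over its
subring of `p`-th powers. -/
structure IsFrobeniusFinite (p : ℕ) (U : X.Opens) : Prop where
  isAffineOpen : IsAffineOpen U
  isNoetherianRing : IsNoetherianRing Γ(X, U)
  exists_generators : ∃ G : Set Γ(X, U), G.Finite ∧ FrobeniusGenerated p G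

theorem IsFrobeniusFinite.basicOpen {p : ℕ} [Fact p.Prime] {U : X.Opens}
    (h : IsFrobeniusFinite p U) (g : Γ(X, U)) : IsFrobeniusFinite p (X.basicOpen g) := by
  have := h.isAffineOpen.isLocalization_basicOpen g
  have := h.isNoetherianRing
  obtain ⟨G, hG, hgen⟩ := h.exists_generators
  exact ⟨h.isAffineOpen.basicOpen g, IsLocalization.isNoetherianRing (.powers g) _ inferInstance,
    _, hG.image _, hgen.of_isLocalization (.powers g)⟩

theorem isDomain_basicOpen {U : X.Opens} (hU : IsAffineOpen U) [IsDomain Γ(X, U)] (g : Γ(X, U))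
    {x : X} (hx : x ∈ X.basicOpen g) : IsDomain Γ(X, X.basicOpen g) := by
  have := hU.isLocalization_basicOpen g
  refine IsLocalization.isDomain_of_le_nonZeroDivisors (M := .powers g) _
    (powers_le_nonZeroDivisors_of_noZeroDivisors ?_)
  rintro rfl
  rw [Scheme.basicOpen_zero] at hx
  exact hx

theorem exists_isFrobeniusFinite {p : ℕ} [Fact p.Prime] {k : Type u} [Field k] [CharP k p]
    [PerfectRing k p] {f : X ⟶ Spec (CommRingCat.of k)} (hX : IsNormal X)
    (hf : LocallyEssFiniteType f) (x : X) :
    ∃ U : X.Opens, x ∈ U ∧ IsFrobeniusFinite p U ∧ IsDomain Γ(X, U) := by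
  obtain ⟨U, hx, hU, hft⟩ := hf x
  let e := (Scheme.ΓSpecIso (CommRingCat.of k)).commRingCatIsoToRingEquiv
  have hgood : IsFrobeniusFinite p U := by
    let : Algebra Γ(Spec (CommRingCat.of k), ⊤) Γ(X, U) := (f.appLE ⊤ U le_top).hom.toAlgebra
    have : Algebra.EssFiniteType Γ(Spec (CommRingCat.of k), ⊤) Γ(X, U) := hft
    have : IsNoetherianRing Γ(Spec (CommRingCat.of k), ⊤) :=
      isNoetherianRing_of_ringEquiv k e.symm
    refine ⟨hU, Algebra.EssFiniteType.isNoetherianRing Γ(Spec (CommRingCat.of k), ⊤) _,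
      FrobeniusGenerated.of_essFiniteType (R := Γ(Spec (CommRingCat.of k), ⊤)) fun r => ?_⟩
    obtain ⟨s, hs⟩ := (PerfectRing.bijective_frobenius (R := k) (p := p)).2 (e r)
    refine ⟨e.symm s, e.injective ?_⟩
    rw [map_pow, RingEquiv.apply_symm_apply]
    exact hs
  let : Algebra Γ(X, U) (X.presheaf.stalk x) :=
    TopCat.Presheaf.algebra_section_stalk X.presheaf ⟨x, hx⟩
  have hloc : IsLocalization.AtPrime (X.presheaf.stalk x) (hU.primeIdealOf ⟨x, hx⟩).asIdeal :=
    hU.isLocalization_stalk ⟨x, hx⟩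
  have := hX.isDomain x
  have := hgood.isNoetherianRing
  obtain ⟨g, hg, hdom⟩ := exists_isDomain_away (hU.primeIdealOf ⟨x, hx⟩).asIdeal
    (X.presheaf.stalk x)
  have := hU.isLocalization_basicOpen g
  refine ⟨X.basicOpen g, ?_, hgood.basicOpen g, hdom _⟩
  rw [X.mem_basicOpen _ x hx]
  exact (IsLocalization.AtPrime.isUnit_to_map_iff (X.presheaf.stalk x) _ g).2 hg

theorem isIntegrallyClosed_sections (hX : IsNormal X) {U : X.Opens} (hU : IsAffineOpen U)
    [IsDomain Γ(X, U)] : IsIntegrallyClosed Γ(X, U) := by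
  refine IsIntegrallyClosed.of_localization_maximal fun P _ _ => ?_
  let y : PrimeSpectrum Γ(X, U) := ⟨P, inferInstance⟩
  have hy : hU.fromSpec y ∈ U := hU.opensRange_fromSpec.le ⟨y, rfl⟩
  let : Algebra Γ(X, U) (X.presheaf.stalk (hU.fromSpec y)) :=
    TopCat.Presheaf.algebra_section_stalk X.presheaf ⟨hU.fromSpec y, hy⟩
  have hloc : IsLocalization.AtPrime (X.presheaf.stalk (hU.fromSpec y)) P :=
    hU.isLocalization_stalk' y hy
  have := hX.isIntegrallyClosed (hU.fromSpec y)
  exact IsIntegrallyClosed.of_equiv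
    (IsLocalization.algEquiv P.primeCompl (X.presheaf.stalk (hU.fromSpec y))
      (Localization.AtPrime P)).toRingEquiv

theorem isFractionRing_of_isLocalization_atPrime {A S L : Type*} [CommRing A] [IsDomain A]
    [CommRing S] [Algebra A S] (P : Ideal A) [P.IsPrime] [IsLocalization.AtPrime S P] [Field L]
    [Algebra S L] [IsFractionRing S L] [Algebra A L] [IsScalarTower A S L] :
    IsFractionRing A L := by
  have hinj : Function.Injective (algebraMap A L) := by
    rw [IsScalarTower.algebraMap_eq A S L]
    exact (IsFractionRing.injective S L).comp
      (IsLocalization.injective S P.primeCompl_le_nonZeroDivisors)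
  have : FaithfulSMul A L := (faithfulSMul_iff_algebraMap_injective A L).2 hinj
  refine IsFractionRing.of_field A L fun z => ?_
  obtain ⟨a, b, hb, rfl⟩ := IsFractionRing.div_surjective (A := S) z
  obtain ⟨a, s, rfl⟩ := IsLocalization.exists_mk'_eq P.primeCompl a
  obtain ⟨b, t, rfl⟩ := IsLocalization.exists_mk'_eq P.primeCompl b
  have hs (s : P.primeCompl) : algebraMap A L s ≠ 0 := fun h =>
    s.2 (hinj (h.trans (map_zero _).symm) ▸ P.zero_mem)
  have hmk (a : A) (s : P.primeCompl) :
      algebraMap S L (IsLocalization.mk' S a s) = algebraMap A L a / algebraMap A L s := by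
    rw [eq_div_iff (hs s), IsScalarTower.algebraMap_apply A S L s, ← map_mul,
      IsLocalization.mk'_spec, ← IsScalarTower.algebraMap_apply]
  refine ⟨a * t, b * s, ?_⟩
  rw [hmk, hmk, map_mul, map_mul]
  have := hs s
  have := hs t
  field_simp

/-- Both section rings localize to the stalk at `x`, so they share its fraction field. -/
theorem isFractionRing_restriction {U U' : X.Opens} (hU : IsAffineOpen U) (hU' : IsAffineOpen U')
    [IsDomain Γ(X, U)] [IsDomain Γ(X, U')] (h : U' ≤ U) {x : X} [IsDomain (X.presheaf.stalk x)]
    (hx : x ∈ U') :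
    @IsFractionRing Γ(X, U) _ (FractionRing Γ(X, U')) _
      ((algebraMap Γ(X, U') (FractionRing Γ(X, U'))).comp
        (X.presheaf.map (homOfLE h).op).hom).toAlgebra := by
  let : Algebra Γ(X, U) (X.presheaf.stalk x) :=
    TopCat.Presheaf.algebra_section_stalk X.presheaf ⟨x, h hx⟩
  let : Algebra Γ(X, U') (X.presheaf.stalk x) :=
    TopCat.Presheaf.algebra_section_stalk X.presheaf ⟨x, hx⟩
  let L := FractionRing (X.presheaf.stalk x)
  have hloc : IsLocalization.AtPrime (X.presheaf.stalk x) (hU.primeIdealOf ⟨x, h hx⟩).asIdeal :=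
    hU.isLocalization_stalk ⟨x, h hx⟩
  have hloc' : IsLocalization.AtPrime (X.presheaf.stalk x) (hU'.primeIdealOf ⟨x, hx⟩).asIdeal :=
    hU'.isLocalization_stalk ⟨x, hx⟩
  have := isFractionRing_of_isLocalization_atPrime (A := Γ(X, U)) (S := X.presheaf.stalk x)
    (L := L) (hU.primeIdealOf ⟨x, h hx⟩).asIdeal
  have := isFractionRing_of_isLocalization_atPrime (A := Γ(X, U')) (S := X.presheaf.stalk x)
    (L := L) (hU'.primeIdealOf ⟨x, hx⟩).asIdeal
  refine isFractionRing_comp _ L fun a => ?_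
  rw [IsScalarTower.algebraMap_apply Γ(X, U') (X.presheaf.stalk x) L,
    IsScalarTower.algebraMap_apply Γ(X, U) (X.presheaf.stalk x) L]
  exact congrArg _ (X.presheaf.germ_res_apply (homOfLE h) x hx a)

end

/-! ### Gluing morphisms along an affine basis -/

section Glue

variable {Y Z : Scheme.{u}} {ι : Type*} {V : ι → Y.Opens} (hV : ∀ i, IsAffineOpen (V i))

/-- The open cover by the spectra of a covering family of affine open subsets. -/
def fromSpecCover (hcov : ∀ y, ∃ i, y ∈ V i) : Y.OpenCover where
  I₀ := ι
  X i := Spec Γ(Y, V i)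
  f i := (hV i).fromSpec
  mem₀ := by
    rw [Scheme.presieve₀_mem_precoverage_iff]
    refine ⟨fun y => ?_, fun i => inferInstance⟩
    obtain ⟨i, hi⟩ := hcov y
    exact ⟨i, (hV i).opensRange_fromSpec.ge hi⟩

include hV

theorem hom_ext_of_isAffineOpen (hcov : ∀ y, ∃ i, y ∈ V i) {a b : Y ⟶ Z}
    (h : ∀ i, (hV i).fromSpec ≫ a = (hV i).fromSpec ≫ b) : a = b :=
  Scheme.Cover.hom_ext (fromSpecCover hV hcov) a b h

/-- Morphisms from the members of an affine basis that agree on inclusions can be glued. -/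
theorem exists_glue (hcov : ∀ y, ∃ i, y ∈ V i) (hbasis : Opens.IsBasis (Set.range V))
    (g : ∀ i, Spec Γ(Y, V i) ⟶ Z)
    (hg : ∀ i j (h : V i ≤ V j), Spec.map (Y.presheaf.map (homOfLE h).op) ≫ g j = g i) :
    ∃ m : Y ⟶ Z, ∀ i, (hV i).fromSpec ≫ m = g i := by
  let 𝒰 := fromSpecCover hV hcov
  let : Preorder 𝒰.I₀ := Preorder.lift V
  have hrange (i : 𝒰.I₀) : (𝒰.f i).opensRange = V i := (hV i).opensRange_fromSpec
  have hle {i j : 𝒰.I₀} : i ≤ j ↔ (𝒰.f i).opensRange ≤ (𝒰.f j).opensRange := by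
    rw [hrange, hrange]
    exact Iff.rfl
  have hb : Opens.IsBasis (Set.range fun i => (𝒰.f i).opensRange) := by
    have : (fun i => (𝒰.f i).opensRange) = V := funext hrange
    rw [this]
    exact hbasis
  let : 𝒰.LocallyDirected := Scheme.Cover.LocallyDirected.ofIsBasisOpensRange hle hb
  have htrans {i j : 𝒰.I₀} (hij : i ⟶ j) :
      𝒰.trans hij = Spec.map (Y.presheaf.map (homOfLE (show V i ≤ V j from hij.le)).op) :=
    (cancel_mono (𝒰.f j)).1 <|
      (𝒰.trans_map hij).trans ((hV j).map_fromSpec (hV i) _).symm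
  refine ⟨Scheme.OpenCover.glueMorphismsOfLocallyDirected 𝒰 g fun {i j} hij => ?_, fun i =>
    Scheme.OpenCover.map_glueMorphismsOfLocallyDirected 𝒰 g _ i⟩
  rw [htrans]
  exact hg i j _

end Glue

/-! ### Charts and local comparison isomorphisms -/

section

variable {p : ℕ} [hp : Fact p.Prime] {k : Type u} [Field k] [CharP k p] [PerfectRing k p]
  {X : Scheme.{u}} {f : X ⟶ Spec (CommRingCat.of k)}

namespace FrobeniusLifting

variable (L : FrobeniusLifting p f)

theorem red_restriction {V V' : L.scheme.Opens} (hV : IsAffineOpen V) (hV' : IsAffineOpen V')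
    {U U' : X.Opens} (h : L.incl ⁻¹ᵁ V = U) (h' : L.incl ⁻¹ᵁ V' = U') (i : V' ≤ V) (j : U' ≤ U)
    (x : Γ(L.scheme, V)) :
    (L.thickening hV' h').red ((L.scheme.presheaf.map (homOfLE i).op).hom x) =
      (X.presheaf.map (homOfLE j).op).hom ((L.thickening hV h).red x) := by
  have h1 : L.scheme.presheaf.map (homOfLE i).op ≫ L.incl.appLE V' U' h'.ge =
      L.incl.appLE V U h.ge ≫ X.presheaf.map (homOfLE j).op :=
    (Scheme.Hom.map_appLE _ _ _).trans (Scheme.Hom.appLE_map _ _ _).symm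
  exact congrArg (fun g => g.hom x) h1

theorem frob_restriction {V V' : L.scheme.Opens} (hV : IsAffineOpen V) (hV' : IsAffineOpen V')
    {U U' : X.Opens} (h : L.incl ⁻¹ᵁ V = U) (h' : L.incl ⁻¹ᵁ V' = U') (i : V' ≤ V)
    (x : Γ(L.scheme, V)) :
    (L.thickening hV' h').frob ((L.scheme.presheaf.map (homOfLE i).op).hom x) =
      (L.scheme.presheaf.map (homOfLE i).op).hom ((L.thickening hV h).frob x) := by
  have h1 : L.scheme.presheaf.map (homOfLE i).op ≫ L.frob.appLE V' V' (L.frob_preimage V').ge =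
      L.frob.appLE V V (L.frob_preimage V).ge ≫ L.scheme.presheaf.map (homOfLE i).op :=
    (Scheme.Hom.map_appLE _ _ _).trans (Scheme.Hom.appLE_map _ _ _).symm
  exact congrArg (fun g => g.hom x) h1

theorem red_strMap {V : L.scheme.Opens} (hV : IsAffineOpen V) {U : X.Opens}
    (h : L.incl ⁻¹ᵁ V = U) (w : TruncatedWittVector p 2 k) :
    (L.thickening hV h).red ((L.strMap V).hom w) = ((Scheme.ΓSpecIso _).inv ≫
      (f ≫ Spec.map (CommRingCat.ofHom (W2.residue p k))).appLE ⊤ U le_top).hom w :=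
  congrArg (fun g => g.hom w) (L.appLE_strMap h.ge)

end FrobeniusLifting

/-- Affine open subsets of two liftings with the same special fibre, whose coordinate ring is a
noetherian domain that is finite over its `p`-th powers. -/
structure Chart (L₁ L₂ : FrobeniusLifting p f) where
  /-- The open subset of the special fibre. -/
  U : X.Opens
  /-- The open subset of the first lifting. -/
  V₁ : L₁.scheme.Opens
  /-- The open subset of the second lifting. -/
  V₂ : L₂.scheme.Opens
  preimage₁ : L₁.incl ⁻¹ᵁ V₁ = U
  preimage₂ : L₂.incl ⁻¹ᵁ V₂ = U
  isAffineOpen₁ : IsAffineOpen V₁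
  isAffineOpen₂ : IsAffineOpen V₂
  isFrobeniusFinite : IsFrobeniusFinite p U
  isDomain : IsDomain Γ(X, U)

namespace Chart

variable {L₁ L₂ : FrobeniusLifting p f}

attribute [instance] Chart.isDomain

instance (c : Chart L₁ L₂) : CharP Γ(X, c.U) p :=
  charP_of_natCast_eq_zero ((hasCharP_of_hom f).sections c.U)

theorem le₁_iff {c d : Chart L₁ L₂} : c.V₁ ≤ d.V₁ ↔ c.U ≤ d.U := by
  rw [← L₁.incl_preimage_le_iff, c.preimage₁, d.preimage₁]

theorem le₂_iff {c d : Chart L₁ L₂} : c.V₂ ≤ d.V₂ ↔ c.U ≤ d.U := by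
  rw [← L₂.incl_preimage_le_iff, c.preimage₂, d.preimage₂]

/-- The thickening given by the first lifting. -/
abbrev thickening₁ (c : Chart L₁ L₂) : FrobeniusThickening p Γ(X, c.U) Γ(L₁.scheme, c.V₁) :=
  L₁.thickening c.isAffineOpen₁ c.preimage₁

/-- The thickening given by the second lifting. -/
abbrev thickening₂ (c : Chart L₁ L₂) : FrobeniusThickening p Γ(X, c.U) Γ(L₂.scheme, c.V₂) :=
  L₂.thickening c.isAffineOpen₂ c.preimage₂

theorem exists_splitting (hX : IsNormal X) (c : Chart L₁ L₂) :
    ∃ σ, c.thickening₁.IsCanonicalSplitting σ := by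
  obtain ⟨G, hG, hgen⟩ := c.isFrobeniusFinite.exists_generators
  have := c.isFrobeniusFinite.isNoetherianRing
  have := isIntegrallyClosed_sections hX c.isFrobeniusFinite.isAffineOpen
  exact FrobeniusThickening.exists_isCanonicalSplitting hG hgen c.thickening₁

/-- The comparison isomorphism of the coordinate rings of a chart. -/
def iso (hX : IsNormal X) (c : Chart L₁ L₂) : Γ(L₁.scheme, c.V₁) ≃+* Γ(L₂.scheme, c.V₂) :=
  -- The splitting is canonical for the first lifting only; for the comparison itself any Frobenius
  -- splitting serves.
  FrobeniusThickening.compare c.thickening₁ c.thickening₂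
    (c.exists_splitting hX).choose_spec.isFrobeniusSplitting

theorem red_iso (hX : IsNormal X) (c : Chart L₁ L₂) (x : Γ(L₁.scheme, c.V₁)) :
    c.thickening₂.red (c.iso hX x) = c.thickening₁.red x :=
  FrobeniusThickening.red_compare _ _ _ x

omit [PerfectRing k p] in
theorem exists_mem (c : Chart L₁ L₂) : ∃ x, x ∈ c.U := by
  by_contra! h
  have h1 : c.U = ⊥ := Opens.ext (Set.eq_empty_of_forall_notMem h)
  have h2 : Subsingleton Γ(X, c.U) := h1 ▸ inferInstanceAs (Subsingleton Γ(X, ⊥))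
  exact not_subsingleton _ h2

/-- This is where canonicity is needed: the splittings chosen on the two charts commute with
restriction because both are canonical for the first lifting. -/
theorem iso_restriction (hX : IsNormal X) {c d : Chart L₁ L₂} (h : c.U ≤ d.U)
    (x : Γ(L₁.scheme, d.V₁)) :
    c.iso hX ((L₁.scheme.presheaf.map (homOfLE (le₁_iff.2 h)).op).hom x) =
      (L₂.scheme.presheaf.map (homOfLE (le₂_iff.2 h)).op).hom (d.iso hX x) := by
  obtain ⟨y, hy⟩ := c.exists_mem
  have := hX.isDomain y
  obtain ⟨G, hG, hgen⟩ := d.isFrobeniusFinite.exists_generators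
  have hr₁ := L₁.red_restriction d.isAffineOpen₁ c.isAffineOpen₁ d.preimage₁ c.preimage₁
    (le₁_iff.2 h) h
  have hr₂ := L₂.red_restriction d.isAffineOpen₂ c.isAffineOpen₂ d.preimage₂ c.preimage₂
    (le₂_iff.2 h) h
  have hf₁ := L₁.frob_restriction d.isAffineOpen₁ c.isAffineOpen₁ d.preimage₁ c.preimage₁
    (le₁_iff.2 h)
  have hf₂ := L₂.frob_restriction d.isAffineOpen₂ c.isAffineOpen₂ d.preimage₂ c.preimage₂
    (le₂_iff.2 h)
  exact FrobeniusThickening.compare_map d.thickening₁ d.thickening₂ c.thickening₁ c.thickening₂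
    _ _ (X.presheaf.map (homOfLE h).op).hom _ _ hr₁ hr₂
    (FrobeniusThickening.delta_map _ _ _ _ hr₁ hf₁) (FrobeniusThickening.delta_map _ _ _ _ hr₂ hf₂)
    ((d.exists_splitting hX).choose_spec.map_eq hG hgen (c.exists_splitting hX).choose_spec _ _
      hr₁ hf₁ (isFractionRing_restriction d.isFrobeniusFinite.isAffineOpen
        c.isFrobeniusFinite.isAffineOpen h hy)) x

theorem iso_strMap (hX : IsNormal X) (c : Chart L₁ L₂) (w : TruncatedWittVector p 2 k) :
    c.iso hX ((L₁.strMap c.V₁).hom w) = (L₂.strMap c.V₂).hom w := by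
  refine RingHom.congr_fun (W2.ringHom_ext (φ := (c.iso hX : _ →+* _).comp (L₁.strMap c.V₁).hom)
    (ψ := (L₂.strMap c.V₂).hom) fun w => ?_) w
  refine (c.thickening₂.red_eq_zero_iff _).1 ?_
  rw [map_sub, sub_eq_zero]
  refine (c.red_iso hX _).trans ?_
  rw [L₁.red_strMap, L₂.red_strMap]

/-- Equations of basic opens lift along the surjections on sections over affine opens, so a small
enough open of `X` is cut out by affine opens of both liftings. -/
theorem exists_chart (hX : IsNormal X) (hf : LocallyEssFiniteType f) (x : X)
    {W₁ : L₁.scheme.Opens} {W₂ : L₂.scheme.Opens} (h₁ : L₁.incl x ∈ W₁) (h₂ : L₂.incl x ∈ W₂) :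
    ∃ c : Chart L₁ L₂, x ∈ c.U ∧ c.V₁ ≤ W₁ ∧ c.V₂ ≤ W₂ := by
  obtain ⟨U₀, hx₀, hfin₀, hdom₀⟩ := exists_isFrobeniusFinite (p := p) hX hf x
  obtain ⟨V₁, hV₁, hx₁, hW₁⟩ := exists_isAffineOpen_mem_and_subset h₁
  obtain ⟨V₂, hV₂, hx₂, hW₂⟩ := exists_isAffineOpen_mem_and_subset h₂
  obtain ⟨a, b, hab, hxa⟩ := exists_basicOpen_le_affine_inter hfin₀.isAffineOpen
    (hV₁.preimage L₁.incl) x ⟨hx₀, hx₁⟩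
  obtain ⟨b, rfl⟩ := Scheme.Hom.app_surjective L₁.incl V₁ hV₁ b
  have hfin₁ := hfin₀.basicOpen a
  have hdom₁ := isDomain_basicOpen hfin₀.isAffineOpen a hxa
  rw [← Scheme.preimage_basicOpen] at hab
  obtain ⟨c, d, hcd, hxc⟩ := exists_basicOpen_le_affine_inter hfin₁.isAffineOpen
    (hV₂.preimage L₂.incl) x ⟨hxa, hx₂⟩
  obtain ⟨d, rfl⟩ := Scheme.Hom.app_surjective L₂.incl V₂ hV₂ d
  rw [← Scheme.preimage_basicOpen] at hcd
  have hVb := hV₁.basicOpen b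
  -- Matching the second lifting shrinks the open of `X` again; lifting the new equation shrinks the
  -- affine open of the first lifting accordingly.
  obtain ⟨c, rfl⟩ := (L₁.thickening hVb hab.symm).red_surjective c
  have hpre : L₁.incl ⁻¹ᵁ L₁.scheme.basicOpen c =
      X.basicOpen ((L₁.thickening hVb hab.symm).red c) := by
    refine Eq.trans ?_ (Scheme.basicOpen_appLE L₁.incl _ _ hab.le c).symm
    refine (inf_eq_right.2 ?_).symm
    exact (L₁.incl_preimage_le_iff.2 (L₁.scheme.basicOpen_le c)).trans hab.ge
  exact ⟨⟨_, _, _, hpre, hcd.symm, hVb.basicOpen c, hV₂.basicOpen d, hfin₁.basicOpen _,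
    isDomain_basicOpen hfin₁.isAffineOpen _ hxc⟩, hxc,
    (L₁.scheme.basicOpen_le c).trans ((L₁.scheme.basicOpen_le b).trans hW₁),
    (L₂.scheme.basicOpen_le d).trans hW₂⟩

end Chart

end

/-! ### The global isomorphism -/

section

variable {p : ℕ} [hp : Fact p.Prime] {k : Type u} [Field k] [CharP k p] [PerfectRing k p]
  {X : Scheme.{u}} {f : X ⟶ Spec (CommRingCat.of k)}

namespace Chart

variable {L₁ L₂ : FrobeniusLifting p f} (hX : IsNormal X)

/-- The comparison morphism from the first to the second lifting on a chart. -/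
def hom (c : Chart L₁ L₂) : Spec Γ(L₁.scheme, c.V₁) ⟶ L₂.scheme :=
  Spec.map (CommRingCat.ofHom (c.iso hX).symm.toRingHom) ≫ c.isAffineOpen₂.fromSpec

/-- The comparison morphism from the second to the first lifting on a chart. -/
def inv (c : Chart L₁ L₂) : Spec Γ(L₂.scheme, c.V₂) ⟶ L₁.scheme :=
  Spec.map (CommRingCat.ofHom (c.iso hX).toRingHom) ≫ c.isAffineOpen₁.fromSpec

theorem map_hom {c d : Chart L₁ L₂} (h : c.V₁ ≤ d.V₁) :
    Spec.map (L₁.scheme.presheaf.map (homOfLE h).op) ≫ d.hom hX = c.hom hX := by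
  have h1 : CommRingCat.ofHom (d.iso hX).symm.toRingHom ≫ L₁.scheme.presheaf.map (homOfLE h).op =
      L₂.scheme.presheaf.map (homOfLE (le₂_iff.2 (le₁_iff.1 h))).op ≫
        CommRingCat.ofHom (c.iso hX).symm.toRingHom := by
    ext y
    refine (c.iso hX).injective ?_
    refine (iso_restriction hX (le₁_iff.1 h) ((d.iso hX).symm y)).trans ?_
    refine Eq.trans ?_ ((c.iso hX).apply_symm_apply _).symm
    exact congrArg _ ((d.iso hX).apply_symm_apply y)
  rw [hom, ← Spec.map_comp_assoc, h1, Spec.map_comp, Category.assoc, IsAffineOpen.map_fromSpec]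
  rfl

theorem map_inv {c d : Chart L₁ L₂} (h : c.V₂ ≤ d.V₂) :
    Spec.map (L₂.scheme.presheaf.map (homOfLE h).op) ≫ d.inv hX = c.inv hX := by
  have h1 : CommRingCat.ofHom (d.iso hX).toRingHom ≫ L₂.scheme.presheaf.map (homOfLE h).op =
      L₁.scheme.presheaf.map (homOfLE (le₁_iff.2 (le₂_iff.1 h))).op ≫
        CommRingCat.ofHom (c.iso hX).toRingHom := by
    ext y
    exact (iso_restriction hX (le₂_iff.1 h) y).symm
  rw [inv, ← Spec.map_comp_assoc, h1, Spec.map_comp, Category.assoc, IsAffineOpen.map_fromSpec]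
  rfl

theorem isBasis₁ (hX : IsNormal X) (hf : LocallyEssFiniteType f) :
    Opens.IsBasis (Set.range fun c : Chart L₁ L₂ => c.V₁) := by
  refine Opens.isBasis_iff_nbhd.2 fun {W y} hy => ?_
  obtain ⟨x, rfl⟩ := L₁.surjective_incl y
  obtain ⟨c, hxc, hW, _⟩ := exists_chart (L₂ := L₂) hX hf x hy (W₂ := ⊤) trivial
  exact ⟨_, ⟨c, rfl⟩, c.preimage₁.ge hxc, hW⟩

theorem isBasis₂ (hX : IsNormal X) (hf : LocallyEssFiniteType f) :
    Opens.IsBasis (Set.range fun c : Chart L₁ L₂ => c.V₂) := by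
  refine Opens.isBasis_iff_nbhd.2 fun {W y} hy => ?_
  obtain ⟨x, rfl⟩ := L₂.surjective_incl y
  obtain ⟨c, hxc, _, hW⟩ := exists_chart (L₁ := L₁) hX hf x (W₁ := ⊤) trivial hy
  exact ⟨_, ⟨c, rfl⟩, c.preimage₂.ge hxc, hW⟩

end Chart

theorem exists_mem_of_isBasis {Y : Scheme.{u}} {ι : Type*} {V : ι → Y.Opens}
    (h : Opens.IsBasis (Set.range V)) (y : Y) : ∃ i, y ∈ V i := by
  obtain ⟨_, ⟨i, rfl⟩, hi, _⟩ := Opens.isBasis_iff_nbhd.1 h (Opens.mem_top y)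
  exact ⟨i, hi⟩

theorem FrobeniusLifting.exists_iso (hX : IsNormal X) (hf : LocallyEssFiniteType f)
    (L₁ L₂ : FrobeniusLifting p f) :
    ∃ e : L₁.scheme ≅ L₂.scheme, e.hom ≫ L₂.str = L₁.str ∧ L₁.incl ≫ e.hom = L₂.incl := by
  have hV₁ (c : Chart L₁ L₂) := c.isAffineOpen₁
  have hV₂ (c : Chart L₁ L₂) := c.isAffineOpen₂
  have hb₁ := Chart.isBasis₁ (L₁ := L₁) (L₂ := L₂) hX hf
  have hb₂ := Chart.isBasis₂ (L₁ := L₁) (L₂ := L₂) hX hf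
  have hc₁ := exists_mem_of_isBasis hb₁
  have hc₂ := exists_mem_of_isBasis hb₂
  obtain ⟨m, hm⟩ := exists_glue hV₁ hc₁ hb₁ (fun c => c.hom hX) fun c d => Chart.map_hom hX
  obtain ⟨n, hn⟩ := exists_glue hV₂ hc₂ hb₂ (fun c => c.inv hX) fun c d => Chart.map_inv hX
  have hm' (c : Chart L₁ L₂) : Spec.map (CommRingCat.ofHom (c.iso hX).toRingHom) ≫
      c.isAffineOpen₁.fromSpec ≫ m = c.isAffineOpen₂.fromSpec := by
    rw [hm, Chart.hom, ← Spec.map_comp_assoc, ← CommRingCat.ofHom_comp]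
    have : (c.iso hX).toRingHom.comp (c.iso hX).symm.toRingHom = RingHom.id _ :=
      RingHom.ext (c.iso hX).apply_symm_apply
    rw [this, CommRingCat.ofHom_id, Spec.map_id, Category.id_comp]
  have hn' (c : Chart L₁ L₂) : Spec.map (CommRingCat.ofHom (c.iso hX).symm.toRingHom) ≫
      c.isAffineOpen₂.fromSpec ≫ n = c.isAffineOpen₁.fromSpec := by
    rw [hn, Chart.inv, ← Spec.map_comp_assoc, ← CommRingCat.ofHom_comp]
    have : (c.iso hX).symm.toRingHom.comp (c.iso hX).toRingHom = RingHom.id _ :=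
      RingHom.ext (c.iso hX).symm_apply_apply
    rw [this, CommRingCat.ofHom_id, Spec.map_id, Category.id_comp]
  refine ⟨⟨m, n, hom_ext_of_isAffineOpen hV₁ hc₁ fun c => ?_,
    hom_ext_of_isAffineOpen hV₂ hc₂ fun c => ?_⟩,
    hom_ext_of_isAffineOpen hV₁ hc₁ fun c => ?_,
    hom_ext_of_isAffineOpen (fun c : Chart L₁ L₂ => c.isFrobeniusFinite.isAffineOpen)
      (fun x => ?_) fun c => ?_⟩
  · rw [reassoc_of% hm, Chart.hom, Category.assoc, hn', Category.comp_id]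
  · rw [reassoc_of% hn, Chart.inv, Category.assoc, hm', Category.comp_id]
  · rw [reassoc_of% hm, Chart.hom, Category.assoc, L₂.fromSpec_str, L₁.fromSpec_str,
      ← Spec.map_comp]
    congr 1
    ext w
    exact ((c.iso hX).symm_apply_eq).2 (c.iso_strMap hX w).symm
  · obtain ⟨c, hc⟩ := hc₁ (L₁.incl x)
    exact ⟨c, c.preimage₁.le hc⟩
  -- On each chart, inducing the identity on `X` amounts to the comparison preserving reductions.
  · rw [← IsAffineOpen.SpecMap_appLE_fromSpec_assoc L₁.incl c.isAffineOpen₁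
      c.isFrobeniusFinite.isAffineOpen c.preimage₁.ge, hm, Chart.hom, ← Spec.map_comp_assoc,
      ← IsAffineOpen.SpecMap_appLE_fromSpec L₂.incl c.isAffineOpen₂
      c.isFrobeniusFinite.isAffineOpen c.preimage₂.ge]
    congr 2
    ext y
    refine (c.red_iso hX _).symm.trans ?_
    exact congrArg c.thickening₂.red ((c.iso hX).apply_symm_apply y)

end

end FrobLift

end

theorem mainTheorem7 (p : ℕ) [Fact p.Prime] (k : Type u) [Field k] [CharP k p] [PerfectRing k p]
    (X : Scheme.{u}) (f : X ⟶ Spec (CommRingCat.of k)) (hX : FrobLift.IsNormal X)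
    (hf : FrobLift.LocallyEssFiniteType f) (L₁ L₂ : FrobLift.FrobeniusLifting p f) :
    ∃ e : L₁.scheme ≅ L₂.scheme, e.hom ≫ L₂.str = L₁.str ∧ L₁.incl ≫ e.hom = L₂.incl :=
  FrobLift.FrobeniusLifting.exists_iso hX hf L₁ L₂
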